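/- Consider four qubits $A',B',A'',B''$ with state space $\mathcal H_{A'}\otimes\mathcal H_{B'}\otimes\mathcal H_{A''}\otimes\mathcal H_{B''}$, each factor being $\mathbb C^2$. Let $\mathcal R$ be the set of density matrices (positive semidefinite, trace one) on this space that commute with $U\otimes U\otimes V\otimes V$ for all $U,V$ in the single-qubit Pauli group, i.e. the group generated by the Pauli matrices $\sigma_x,\sigma_y,\sigma_z$. Let $|\Phi_{1}\rangle,|\Phi_2\rangle=\frac1{\sqrt2}(|00\rangle\pm|11\rangle)$ and $|\Phi_3\rangle,|\Phi_4\rangle=\frac1{\sqrt2}(|01\rangle\pm|10\rangle)$ be the Bell basis, let $\Pi_k=|\Phi_k\rangle\langle\Phi_k|$, and for a real $4\times4$ matrix $r$ put $$\rho_r=\sum_{i,j=1}^4 r_{ij}\,\Pi_i\otimes\Pi_j ,$$ where $\Pi_i$ acts on $\mathcal H_{A'}\otimes\mathcal H_{B'}$ and $\Pi_j$ on $\mathcal H_{A''}\otimes\mathcal H_{B''}$. A state is called separable across the cut $A'A''|B'B''$ if it is a (finite) convex combination of product states $\alpha\otimes\beta$ with $\alpha$ a density matrix on $\mathcal H_{A'}\otimes\mathcal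 H_{A''}$ and $\beta$ a density matrix on $\mathcal H_{B'}\otimes\mathcal H_{B''}$. Let $\mathcal P_s$ be the convex hull of all matrices obtained by independently permuting the rows and the columns of $$D_0=\frac14\begin{pmatrix}1&0&0&0\\0&1&0&0\\0&0&1&0\\0&0&0&1\end{pmatrix},\qquad G_0=\frac14\begin{pmatrix}1&1&0&0\\1&1&0&0\\0&0&0&0\\0&0&0&0\end{pmatrix}.$$ Theorem. The map $r\mapsto\rho_r$ is injective on real $4\times4$ matrices, and $\mathcal R$ is exactly the set of $\rho_r$ with $r_{ij}\ge0$ for all $i,j$ and $\sum_{i,j}r_{ij}=1$. For every $r$ with $\rho_r\in\mathcal R$, the state $\rho_r$ is separable across $A'A''|B'B''$ if and only if $r\in\mathcal P_s$. Equivalently, the set of states in $\mathcal R$ that are separable across this cut is $\{\rho_r: r\in\mathcal P_s\}$. -/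

import Mathlib

open scoped Kronecker ComplexOrder

noncomputable section

namespace FourQubit

/-- Index set of the computational basis of two qubits. -/
abbrev TwoQubit : Type := Fin 2 × Fin 2

/-- Index set of the computational basis of four qubits, in the order `A', B', A'', B''`,
grouped as `(A', B'), (A'', B'')`. -/
abbrev Idx : Type := TwoQubit × TwoQubit

/-- A state (density matrix): positive semidefinite with unit trace. -/
def IsState {n : Type} [Fintype n] (ρ : Matrix n n ℂ) : Prop :=
  ρ.PosSemidef ∧ ρ.trace = 1

/-- The Pauli matrices. -/
def sigmaX : Matrix (Fin 2) (Fin 2) ℂ := !![0, 1; 1, 0]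

def sigmaY : Matrix (Fin 2) (Fin 2) ℂ := !![0, -Complex.I; Complex.I, 0]

def sigmaZ : Matrix (Fin 2) (Fin 2) ℂ := !![1, 0; 0, -1]

lemma sigmaX_mem : sigmaX ∈ Matrix.unitaryGroup (Fin 2) ℂ := by
  rw [Matrix.mem_unitaryGroup_iff]
  ext i j
  fin_cases i <;> fin_cases j <;>
    simp [sigmaX, Matrix.mul_apply, Matrix.star_apply, Fin.sum_univ_two]

lemma sigmaY_mem : sigmaY ∈ Matrix.unitaryGroup (Fin 2) ℂ := by
  rw [Matrix.mem_unitaryGroup_iff]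
  ext i j
  fin_cases i <;> fin_cases j <;>
    simp [sigmaY, Matrix.mul_apply, Matrix.star_apply, Fin.sum_univ_two]

lemma sigmaZ_mem : sigmaZ ∈ Matrix.unitaryGroup (Fin 2) ℂ := by
  rw [Matrix.mem_unitaryGroup_iff]
  ext i j
  fin_cases i <;> fin_cases j <;>
    simp [sigmaZ, Matrix.mul_apply, Matrix.star_apply, Fin.sum_univ_two]

/-- The single-qubit Pauli group, generated by the Pauli matrices. -/
def pauliGroup : Subgroup (Matrix.unitaryGroup (Fin 2) ℂ) :=
  Subgroup.closure {⟨sigmaX, sigmaX_mem⟩, ⟨sigmaY, sigmaY_mem⟩, ⟨sigmaZ, sigmaZ_mem⟩}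

/-- The set `R` of four-qubit states commuting with `U ⊗ U ⊗ V ⊗ V` for all `U`, `V` in the
Pauli group. -/
def symStates : Set (Matrix Idx Idx ℂ) :=
  {ρ | IsState ρ ∧ ∀ U ∈ pauliGroup, ∀ V ∈ pauliGroup,
    Commute ρ (((U : Matrix (Fin 2) (Fin 2) ℂ) ⊗ₖ (U : Matrix (Fin 2) (Fin 2) ℂ)) ⊗ₖ
      ((V : Matrix (Fin 2) (Fin 2) ℂ) ⊗ₖ (V : Matrix (Fin 2) (Fin 2) ℂ)))}

/-- The computational basis vector `|a⟩|b⟩` of two qubits. -/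
def ket (a b : Fin 2) : TwoQubit → ℂ := Pi.single (a, b) 1

/-- The Bell basis `Φ₁, Φ₂, Φ₃, Φ₄` (indexed from `0`). -/
def bellVec : Fin 4 → TwoQubit → ℂ :=
  ![((1 / Real.sqrt 2 : ℝ) : ℂ) • (ket 0 0 + ket 1 1),
    ((1 / Real.sqrt 2 : ℝ) : ℂ) • (ket 0 0 - ket 1 1),
    ((1 / Real.sqrt 2 : ℝ) : ℂ) • (ket 0 1 + ket 1 0),
    ((1 / Real.sqrt 2 : ℝ) : ℂ) • (ket 0 1 - ket 1 0)]

/-- The Bell projector `|Φ_k⟩⟨Φ_k|`. -/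
def bellProj (k : Fin 4) : Matrix TwoQubit TwoQubit ℂ :=
  Matrix.vecMulVec (bellVec k) (star (bellVec k))

/-- The operator `∑ r i j • Π_i ⊗ Π_j`, with `Π_i` acting on `A' B'` and `Π_j` on `A'' B''`. -/
def bellOp (r : Matrix (Fin 4) (Fin 4) ℝ) : Matrix Idx Idx ℂ :=
  ∑ i, ∑ j, ((r i j : ℝ) : ℂ) • (bellProj i ⊗ₖ bellProj j)

/-- A bipartite operator is a separable state: it is a convex combination of product states. -/
def IsSeparable {m n : Type} [Fintype m] [Fintype n] (ρ : Matrix (m × n) (m × n) ℂ) : Prop :=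
  ρ ∈ convexHull ℝ {σ : Matrix (m × n) (m × n) ℂ |
    ∃ (α : Matrix m m ℂ) (β : Matrix n n ℂ), IsState α ∧ IsState β ∧ σ = α ⊗ₖ β}

/-- Regrouping of the four tensor factors: `((A', B'), (A'', B''))` becomes
`((A', A''), (B', B''))`. -/
def regroup (ρ : Matrix Idx Idx ℂ) : Matrix (TwoQubit × TwoQubit) (TwoQubit × TwoQubit) ℂ :=
  Matrix.reindex (Equiv.prodProdProdComm (Fin 2) (Fin 2) (Fin 2) (Fin 2))
    (Equiv.prodProdProdComm (Fin 2) (Fin 2) (Fin 2) (Fin 2)) ρ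

/-- Separability across the cut `A' A'' | B' B''`. -/
def IsSeparableAB (ρ : Matrix Idx Idx ℂ) : Prop := IsSeparable (regroup ρ)

def D0 : Matrix (Fin 4) (Fin 4) ℝ :=
  (1 / 4 : ℝ) • !![1, 0, 0, 0; 0, 1, 0, 0; 0, 0, 1, 0; 0, 0, 0, 1]

def G0 : Matrix (Fin 4) (Fin 4) ℝ :=
  (1 / 4 : ℝ) • !![1, 1, 0, 0; 1, 1, 0, 0; 0, 0, 0, 0; 0, 0, 0, 0]

/-- The polytope `P_s`, in terms of coefficient matrices: the convex hull of all matrices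
obtained from `D0` and `G0` by independently permuting rows and columns. -/
def polytopePs : Set (Matrix (Fin 4) (Fin 4) ℝ) :=
  convexHull ℝ {M | ∃ σ τ : Equiv.Perm (Fin 4), M = D0.submatrix σ τ ∨ M = G0.submatrix σ τ}

end FourQubit

end

open scoped Kronecker ComplexOrder

noncomputable section

namespace FourQubit

/-! The sixteen products `Π_i ⊗ Π_j` are rank-one projectors, sum to the identity and lie in the
span of the operators `σ_k ⊗ σ_k ⊗ σ_l ⊗ σ_l`. A state commuting with all of these is therefore
diagonal in the projectors (`symStates_eq`).

Points of `P_s` are separable: `D0` gives a state proportional to the sum of `σ_k^{⊗4}`, which is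
unchanged by regrouping the factors, `G0` gives classically correlated bits, and local unitaries
realise all permutations of the Bell projectors (`locallyImplements`).

Conversely, let `hat r k l` be the coefficient of `r` on `σ_k ⊗ σ_k ⊗ σ_l ⊗ σ_l`. For `α ⊗ β` it is
the product of the Pauli correlations of `α` and `β`. Certain sums of squared correlations are
constant on pure states: five pairwise anticommuting Paulis give 1, and the ten remaining nontrivial
ones give 2. Cauchy–Schwarz turns this into bounds on sums of `|hat r k l|`. With positivity of the
state and of its partial transpose these form `HatFacets` (`hatFacets_of_isSeparable`).

It remains to show that `HatFacets` and total weight one imply `r ∈ P_s`. Permutations,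
transposition and partial transposition allow the assumption that row 0 has the largest deviation of
a row or column sum from 1/4, with positive sign. One then seeks `r = Δ + Γ`. Here `Δ` is
nonnegative with all line sums equal to `1/2 - rowSum r 0`, hence a combination of permuted `D0` by
Birkhoff. The matrix `Γ` is a sum over `k ≠ 0` of matrices whose rows 0 and `k` both equal a vector
`y_k` and whose other rows vanish. Such a matrix is a combination of permuted `G0` once every entry
of `y_k` is at most half of its sum. The line sums of `Δ` force `∑ j, y_k j` to be `supply` and `∑
k, y_k j` to be `demand`; the remaining conditions say `0 ≤ y_k j ≤ capacity`. This is a transport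
problem, solvable when its cut conditions hold (`exists_transport`), and they follow from the
inequalities `Facets`, which `HatFacets` implies. -/

/-! ### Capacitated transport by least squares. -/

open Finset in
/-- A capacitated transport problem satisfying the cut conditions has a solution. -/
theorem exists_transport {K J : Type*} [Fintype K] [Fintype J] [DecidableEq K] [DecidableEq J]
    (c : K → J → ℝ) (s : K → ℝ) (t : J → ℝ) (hc : 0 ≤ c) (hsum : ∑ k, s k = ∑ j, t j)
    (hcut : ∀ (I : Finset K) (A : Finset J),
      ∑ k ∈ I, s k ≤ ∑ j ∈ Aᶜ, t j + ∑ k ∈ I, ∑ j ∈ A, c k j) :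
    ∃ y : K → J → ℝ, 0 ≤ y ∧ y ≤ c ∧ (∀ k, ∑ j, y k j = s k) ∧ ∀ j, ∑ k, y k j = t j := by
  -- Minimise the squared residuals over the compact box `0 ≤ y ≤ c`; the cut conditions will force
  -- the residuals of a minimiser to vanish.
  let Φ : (K → J → ℝ) → ℝ := fun y =>
    ∑ k, (s k - ∑ j, y k j) ^ 2 + ∑ j, (t j - ∑ k, y k j) ^ 2
  have hΦ : Continuous Φ := by fun_prop
  obtain ⟨y, ⟨hy0, hyc⟩, hmin⟩ :=
    (isCompact_Icc (a := (0 : K → J → ℝ)) (b := c)).exists_isMinOn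
      (Set.nonempty_Icc.2 hc) hΦ.continuousOn
  -- Changing one entry by `ε` changes `Φ` by twice the right-hand side.
  have hstep : ∀ k j (ε : ℝ), 0 ≤ y k j + ε → y k j + ε ≤ c k j →
      0 ≤ ε ^ 2 - ε * ((s k - ∑ j, y k j) + (t j - ∑ k, y k j)) := by
    intro k j ε h0 h1
    have hmem : y + Pi.single k (Pi.single j ε) ∈ Set.Icc (0 : K → J → ℝ) c := by
      constructor <;> intro k' j' <;> by_cases hk : k' = k
      · subst hk
        by_cases hj : j' = j
        · subst hj; simpa using h0
        · simpa [hj] using hy0 k' j'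
      · simpa [hk] using hy0 k' j'
      · subst hk
        by_cases hj : j' = j
        · subst hj; simpa using h1
        · simpa [hj] using hyc k' j'
      · simpa [hk] using hyc k' j'
    have hle : Φ y ≤ Φ (y + Pi.single k (Pi.single j ε)) := hmin hmem
    have hrow : ∀ k', ∑ j', (y + Pi.single k (Pi.single j ε) : K → J → ℝ) k' j' =
        ∑ j', y k' j' + if k' = k then ε else 0 := by
      intro k'
      by_cases hk : k' = k
      · subst hk; simp [sum_add_distrib]
      · simp [hk]
    have hcol : ∀ j', ∑ k', (y + Pi.single k (Pi.single j ε) : K → J → ℝ) k' j' =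
        ∑ k', y k' j' + if j' = j then ε else 0 := by
      intro j'
      have : ∀ k', (Pi.single k (Pi.single j ε) : K → J → ℝ) k' j' =
          if k' = k then (if j' = j then ε else 0) else 0 := by
        intro k'
        by_cases hk : k' = k
        · subst hk; simp [Pi.single_apply]
        · simp [hk]
      simp [sum_add_distrib, this]
    have hsq : ∀ a b : ℝ, ∀ p : Prop, [Decidable p] → (a - (b + if p then ε else 0)) ^ 2 =
        (a - b) ^ 2 + if p then ε ^ 2 - 2 * ε * (a - b) else 0 := by
      intro a b p _
      split_ifs <;> ring
    simp only [Φ, hrow, hcol, hsq, sum_add_distrib, sum_ite_eq', mem_univ, if_true] at hle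
    linarith
  set d : K → ℝ := fun k => s k - ∑ j, y k j with hd
  set e : J → ℝ := fun j => t j - ∑ k, y k j with he
  have hfull : ∀ k j, 0 < d k + e j → y k j = c k j := by
    intro k j h
    by_contra hne
    have hlt : 0 < c k j - y k j := sub_pos.2 (lt_of_le_of_ne (hyc k j) hne)
    -- Below half of `d k + e j` the linear term beats `ε ^ 2`, so an unsaturated entry could be
    -- increased profitably.
    have hε : 0 < min (c k j - y k j) ((d k + e j) / 2) := lt_min hlt (by linarith)
    have hε1 := min_le_left (c k j - y k j) ((d k + e j) / 2)
    have hε2 := min_le_right (c k j - y k j) ((d k + e j) / 2)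
    have h0 := hy0 k j
    simp only [Pi.zero_apply] at h0
    have := hstep k j _ (by linarith) (by linarith)
    change 0 ≤ _ ^ 2 - _ * (d k + e j) at this
    nlinarith
  have hzero : ∀ k j, d k + e j < 0 → y k j = 0 := by
    intro k j h
    by_contra hne
    have h0 := hy0 k j
    simp only [Pi.zero_apply] at h0
    have hlt : 0 < y k j := lt_of_le_of_ne h0 (Ne.symm hne)
    have hε : 0 < min (y k j) (-(d k + e j) / 2) := lt_min hlt (by linarith)
    have hε1 := min_le_left (y k j) (-(d k + e j) / 2)
    have hε2 := min_le_right (y k j) (-(d k + e j) / 2)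
    have h1 := hyc k j
    have := hstep k j (-min (y k j) (-(d k + e j) / 2)) (by linarith) (by linarith)
    change 0 ≤ _ ^ 2 - _ * (d k + e j) at this
    nlinarith
  have hde : ∑ k, d k = ∑ j, e j := by
    simp only [hd, he, sum_sub_distrib, hsum]
    rw [sum_comm]
  -- The critical cut: entries in `I × A` are saturated and those in `Iᶜ × Aᶜ` vanish, so its cut
  -- condition reads `∑ I, d ≤ ∑ Aᶜ, e`. The left side is nonnegative and the right side
  -- nonpositive.
  let I : Finset K := univ.filter fun k => 0 < d k
  let A : Finset J := univ.filter fun j => 0 ≤ e j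
  have hI : ∀ k ∈ I, ∑ j ∈ A, y k j = ∑ j ∈ A, c k j := by
    intro k hk
    refine sum_congr rfl fun j hj => hfull k j ?_
    simp only [I, A, mem_filter, mem_univ, true_and] at hk hj
    linarith
  have hA : ∀ j ∈ Aᶜ, ∑ k ∈ Iᶜ, y k j = 0 := by
    intro j hj
    refine sum_eq_zero fun k hk => hzero k j ?_
    simp only [I, A, mem_compl, mem_filter, mem_univ, true_and, not_lt, not_le] at hk hj
    linarith
  have h1 : ∑ k ∈ I, s k =
      ∑ k ∈ I, d k + (∑ k ∈ I, ∑ j ∈ A, c k j + ∑ k ∈ I, ∑ j ∈ Aᶜ, y k j) := by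
    rw [← sum_congr rfl hI, ← sum_add_distrib, ← sum_add_distrib]
    refine sum_congr rfl fun k _ => ?_
    rw [sum_add_sum_compl]
    simp [hd]
  have h2 : ∑ j ∈ Aᶜ, t j = ∑ j ∈ Aᶜ, e j + ∑ k ∈ I, ∑ j ∈ Aᶜ, y k j := by
    rw [sum_comm (s := I), ← sum_add_distrib]
    refine sum_congr rfl fun j hj => ?_
    have := hA j hj
    have hsplit := sum_add_sum_compl I fun k => y k j
    simp only [he]
    linarith
  have h3 := hcut I A
  have hd0 : ∀ k ∈ I, 0 ≤ d k := fun k hk => by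
    simp only [I, mem_filter, mem_univ, true_and] at hk
    exact hk.le
  have he0 : ∀ j ∈ Aᶜ, e j ≤ 0 := fun j hj => by
    simp only [A, mem_compl, mem_filter, mem_univ, true_and, not_le] at hj
    exact hj.le
  have h4 := sum_nonneg hd0
  have h5 := sum_nonpos he0
  have h6 : ∑ k ∈ I, d k = 0 := by linarith
  have h7 : ∑ j ∈ Aᶜ, e j = 0 := by linarith
  have hdle : ∀ k, d k ≤ 0 := by
    intro k
    by_contra hk
    have hkI : k ∈ I := by simpa [I] using hk
    exact hk ((sum_eq_zero_iff_of_nonneg hd0).1 h6 k hkI).le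
  have hege : ∀ j, 0 ≤ e j := by
    intro j
    by_contra hj
    have hjA : j ∈ Aᶜ := by simpa [A] using hj
    exact hj ((sum_eq_zero_iff_of_nonpos he0).1 h7 j hjA).ge
  have h8 := sum_nonpos fun k (_ : k ∈ univ) => hdle k
  have h9 := sum_nonneg fun j (_ : j ∈ univ) => hege j
  have hd1 : ∀ k, d k = 0 := fun k =>
    (sum_eq_zero_iff_of_nonpos fun k _ => hdle k).1 (by linarith) k (mem_univ k)
  have he1 : ∀ j, e j = 0 := fun j =>
    (sum_eq_zero_iff_of_nonneg fun j _ => hege j).1 (by linarith) j (mem_univ j)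
  exact ⟨y, hy0, hyc, fun k => (sub_eq_zero.1 (hd1 k)).symm, fun j => (sub_eq_zero.1 (he1 j)).symm⟩

/-! ### Facet inequalities and the linear certificate of each cut. -/

section

/-- The sum of row `i`. -/
def rowSum (r : Matrix (Fin 4) (Fin 4) ℝ) (i : Fin 4) : ℝ := ∑ j, r i j

/-- The sum of column `j`. -/
def colSum (r : Matrix (Fin 4) (Fin 4) ℝ) (j : Fin 4) : ℝ := ∑ i, r i j

/-- The sum of all entries. -/
def entrySum (r : Matrix (Fin 4) (Fin 4) ℝ) : ℝ := ∑ i, ∑ j, r i j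

/-- Four labels which exhaust `Fin 4`. -/
def Exhaust (a b c d : Fin 4) : Prop := a ≠ b ∧ a ≠ c ∧ a ≠ d ∧ b ≠ c ∧ b ≠ d ∧ c ≠ d

instance (a b c d : Fin 4) : Decidable (Exhaust a b c d) := by unfold Exhaust; infer_instance

lemma Exhaust.univ_eq : ∀ {a b c d : Fin 4}, Exhaust a b c d → Finset.univ = {a, b, c, d} := by
  decide

lemma Exhaust.sum_eq {a b c d : Fin 4} (h : Exhaust a b c d) (f : Fin 4 → ℝ) :
    ∑ i, f i = f a + f b + f c + f d := by
  have hu := h.univ_eq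
  obtain ⟨hab, hac, had, hbc, hbd, hcd⟩ := h
  rw [hu, Finset.sum_insert (by simp [hab, hac, had]), Finset.sum_insert (by simp [hbc, hbd]),
    Finset.sum_insert (by simp [hcd]), Finset.sum_singleton]
  ring

lemma Exhaust.swap₁₂ {a b c d : Fin 4} (h : Exhaust a b c d) : Exhaust b a c d :=
  ⟨h.1.symm, h.2.2.2.1, h.2.2.2.2.1, h.2.1, h.2.2.1, h.2.2.2.2.2⟩

lemma Exhaust.swap₂₃ {a b c d : Fin 4} (h : Exhaust a b c d) : Exhaust a c b d :=
  ⟨h.2.1, h.1, h.2.2.1, h.2.2.2.1.symm, h.2.2.2.2.2, h.2.2.2.2.1⟩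

lemma Exhaust.swap₃₄ {a b c d : Fin 4} (h : Exhaust a b c d) : Exhaust a b d c :=
  ⟨h.1, h.2.2.1, h.2.1, h.2.2.2.2.1, h.2.2.2.1, h.2.2.2.2.2.symm⟩

/-- Linear inequalities which cut out the cone over the polytope `P_s`. -/
structure Facets (r : Matrix (Fin 4) (Fin 4) ℝ) : Prop where
  pos : ∀ i j, 0 ≤ r i j
  ppt : ∀ i j, (rowSum r i + colSum r j) / 2 - entrySum r / 4 ≤ r i j
  col_pair : ∀ i i' j, i ≠ i' → r i j + r i' j ≤ (rowSum r i + colSum r j) / 2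
  row_pair : ∀ i j j', j ≠ j' → r i j + r i j' ≤ (rowSum r i + colSum r j) / 2
  path : ∀ z i i' p j j' j'' q, Exhaust z i i' p → Exhaust j j' j'' q →
    entrySum r / 4 - (rowSum r p + colSum r q) / 2 ≤ r i j + r i j' + r i' j' + r i' j''

/-- Normalisation, together with maximality of the deviation of the row sum `0` from `1 / 4`. -/
structure Dominant (r : Matrix (Fin 4) (Fin 4) ℝ) : Prop where
  total : entrySum r = 1
  row_le : ∀ i, rowSum r i ≤ rowSum r 0
  col_le : ∀ j, colSum r j ≤ rowSum r 0
  row_ge : ∀ i, 1 / 2 ≤ rowSum r 0 + rowSum r i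
  col_ge : ∀ j, 1 / 2 ≤ rowSum r 0 + colSum r j

/-- Supplies of the transport problem which decomposes `r`. -/
def supply (r : Matrix (Fin 4) (Fin 4) ℝ) (p : Fin 4) : ℝ := rowSum r p + rowSum r 0 - 1 / 2

/-- Demands of the transport problem which decomposes `r`. -/
def demand (r : Matrix (Fin 4) (Fin 4) ℝ) (j : Fin 4) : ℝ :=
  (colSum r j + rowSum r 0 - 1 / 2) / 2

/-- Capacities of the transport problem which decomposes `r`. -/
def capacity (r : Matrix (Fin 4) (Fin 4) ℝ) (p j : Fin 4) : ℝ := min (r p j) (supply r p / 2)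

section Cuts

variable {r : Matrix (Fin 4) (Fin 4) ℝ} {p q m a b c d : Fin 4}

lemma rowSum_eq (hc : Exhaust a b c d) (i : Fin 4) :
    rowSum r i = r i a + r i b + r i c + r i d := hc.sum_eq _

lemma colSum_eq (hr : Exhaust 0 p q m) (j : Fin 4) :
    colSum r j = r 0 j + r p j + r q j + r m j := hr.sum_eq fun i => r i j

lemma Dominant.rows (h : Dominant r) (hr : Exhaust 0 p q m) :
    rowSum r 0 + rowSum r p + rowSum r q + rowSum r m = 1 := by
  rw [← h.total]; exact (hr.sum_eq (rowSum r)).symm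

lemma Dominant.cols (h : Dominant r) (hc : Exhaust a b c d) :
    colSum r a + colSum r b + colSum r c + colSum r d = 1 := by
  rw [← h.total]
  exact (hc.sum_eq (colSum r)).symm.trans (Finset.sum_comm (f := fun j i => r i j))

lemma Facets.ppt' (h : Facets r) (hd : Dominant r) (i j : Fin 4) :
    (rowSum r i + colSum r j) / 2 - 1 / 4 ≤ r i j := by
  have := h.ppt i j; rwa [hd.total] at this

lemma supply_nonneg (hd : Dominant r) (p : Fin 4) : 0 ≤ supply r p := by
  have := hd.row_ge p; unfold supply; linarith

lemma demand_nonneg (hd : Dominant r) (j : Fin 4) : 0 ≤ demand r j := by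
  have := hd.col_ge j; unfold demand; linarith

lemma capacity_nonneg (h : Facets r) (hd : Dominant r) (p j : Fin 4) : 0 ≤ capacity r p j :=
  le_min (h.pos p j) (by have := supply_nonneg hd p; linarith)

lemma sum_demand (hd : Dominant r) (hr : Exhaust 0 p q m)
    (hc : Exhaust a b c d) :
    demand r a + demand r b + demand r c + demand r d = supply r p + supply r q + supply r m := by
  have := hd.rows hr
  have := hd.cols hc
  unfold demand supply
  linarith

/-- The possible values of a sum of truncated terms. -/
lemma sum_min_cases {J : Type*} [DecidableEq J] (A : Finset J) (f : J → ℝ) (t : ℝ)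
    (hf : ∀ j, 0 ≤ f j) (ht : 0 ≤ t) :
    2 * t ≤ ∑ j ∈ A, min (f j) t ∨ ∑ j ∈ A, min (f j) t = ∑ j ∈ A, f j ∨
      ∃ j₀ ∈ A, ∑ j ∈ A, min (f j) t = t + (∑ j ∈ A, f j - f j₀) := by
  by_cases h0 : ∀ j ∈ A, f j ≤ t
  · exact .inr (.inl (Finset.sum_congr rfl fun j hj => min_eq_left (h0 j hj)))
  · push Not at h0
    obtain ⟨j₀, hj₀, hlt⟩ := h0
    rw [← Finset.add_sum_erase A _ hj₀, min_eq_right hlt.le]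
    by_cases h1 : ∀ j ∈ A.erase j₀, f j ≤ t
    · refine .inr (.inr ⟨j₀, hj₀, ?_⟩)
      rw [Finset.sum_congr rfl fun j hj => min_eq_left (h1 j hj), ← Finset.sum_erase_eq_sub hj₀]
    · push Not at h1
      obtain ⟨j₁, hj₁, hlt₁⟩ := h1
      refine .inl ?_
      rw [← Finset.add_sum_erase _ _ hj₁, min_eq_right hlt₁.le]
      have : 0 ≤ ∑ j ∈ (A.erase j₀).erase j₁, min (f j) t :=
        Finset.sum_nonneg fun j _ => le_min (hf j) ht
      linarith

/-- This and the following lemmas through `all_rows_trunc_three` certify the cut conditions after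
each minimum in `capacity` is resolved. The name records the rows of the cut and the number of its
columns, and whether a row is `full` (all entries `r p j`) or `trunc` (one entry replaced by half
the supply). In the `all_rows` lemmas the cut is taken one column at a time and the number counts
truncated rows. -/
lemma one_row_one_full (h : Facets r) (hd : Dominant r) (hc : Exhaust a b c d) :
    supply r p ≤ demand r b + demand r c + demand r d + r p a := by
  simp only [supply, demand]
  linarith [hd.cols hc, hd.row_le p, h.ppt' hd p a]

lemma one_row_one_trunc (hd : Dominant r) (hc : Exhaust a b c d) :
    supply r p ≤ demand r b + demand r c + demand r d + supply r p / 2 := by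
  simp only [supply, demand]
  linarith [hd.cols hc, hd.row_le p, hd.col_le a]

lemma one_row_two_full (h : Facets r) (hd : Dominant r) (hc : Exhaust a b c d) :
    supply r p ≤ demand r c + demand r d + (r p a + r p b) := by
  simp only [supply, demand]
  linarith [hd.cols hc, h.ppt' hd p a, h.ppt' hd p b]

lemma one_row_two_trunc (h : Facets r) (hd : Dominant r) (hc : Exhaust a b c d) :
    supply r p ≤ demand r c + demand r d + (supply r p / 2 + r p b) := by
  simp only [supply, demand]
  linarith [hd.cols hc, h.ppt' hd p b, hd.col_le a]

lemma one_row_three_full (h : Facets r) (hd : Dominant r) (hr : Exhaust 0 p q m)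
    (hc : Exhaust a b c d) :
    supply r p ≤ demand r d + (r p a + r p b + r p c) := by
  simp only [supply, demand]
  linarith [rowSum_eq (r := r) hc 0, rowSum_eq (r := r) hc p,
    rowSum_eq (r := r) hc q, rowSum_eq (r := r) hc m,
    colSum_eq (r := r) hr a, colSum_eq (r := r) hr b, colSum_eq (r := r) hr c,
    colSum_eq (r := r) hr d,
    hd.rows hr, hd.cols hc, h.ppt' hd 0 d, h.pos q d, h.pos m d]

/-- After cancellation this is exactly the facet `row_pair`. -/
lemma one_row_three_trunc (h : Facets r) (hc : Exhaust a b c d) :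
    supply r p ≤ demand r d + (supply r p / 2 + (r p b + r p c)) := by
  have h1 := h.row_pair p d a hc.2.2.1.symm
  have h2 := rowSum_eq (r := r) hc p
  simp only [supply, demand]
  linarith

lemma one_row_four_full (h : Facets r) (hd : Dominant r) (hr : Exhaust 0 p q m)
    (hc : Exhaust a b c d) :
    supply r p ≤ (r p a + r p b + r p c + r p d) := by
  simp only [supply]
  linarith [rowSum_eq (r := r) hc 0, rowSum_eq (r := r) hc p,
    rowSum_eq (r := r) hc q, rowSum_eq (r := r) hc m,
    colSum_eq (r := r) hr a, colSum_eq (r := r) hr b, colSum_eq (r := r) hr c,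
    colSum_eq (r := r) hr d,
    hd.rows hr, hd.cols hc, h.ppt' hd 0 a, h.ppt' hd 0 b, h.ppt' hd 0 c, h.ppt' hd 0 d]

lemma one_row_four_trunc (h : Facets r) (hd : Dominant r) (hr : Exhaust 0 p q m)
    (hc : Exhaust a b c d) :
    supply r p ≤ supply r p / 2 + (r p b + r p c + r p d) := by
  simp only [supply]
  linarith [rowSum_eq (r := r) hc 0, rowSum_eq (r := r) hc p,
    rowSum_eq (r := r) hc q, rowSum_eq (r := r) hc m,
    colSum_eq (r := r) hr a, colSum_eq (r := r) hr b, colSum_eq (r := r) hr c,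
    colSum_eq (r := r) hr d,
    hd.rows hr, hd.cols hc, h.ppt' hd 0 a, h.col_pair p 0 a hr.1.symm]

lemma two_rows_one_full (h : Facets r) (hd : Dominant r) (hr : Exhaust 0 p q m)
    (hc : Exhaust a b c d) :
    supply r p + supply r q ≤ demand r b + demand r c + demand r d + (r p a + r q a) := by
  simp only [supply, demand]
  linarith [rowSum_eq (r := r) hc 0, rowSum_eq (r := r) hc p,
    rowSum_eq (r := r) hc q, rowSum_eq (r := r) hc m,
    colSum_eq (r := r) hr a, colSum_eq (r := r) hr b, colSum_eq (r := r) hr c,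
    colSum_eq (r := r) hr d,
    hd.rows hr, hd.cols hc, hd.row_ge m, h.col_pair m 0 a hr.2.2.1.symm]

lemma two_rows_one_mixed (h : Facets r) (hd : Dominant r) (hr : Exhaust 0 p q m)
    (hc : Exhaust a b c d) :
    supply r p + supply r q ≤ demand r b + demand r c + demand r d + (r p a + supply r q / 2) := by
  simp only [supply, demand]
  linarith [hd.rows hr, hd.cols hc, hd.row_ge m, h.ppt' hd p a]

lemma two_rows_one_trunc (hd : Dominant r) (hr : Exhaust 0 p q m)
    (hc : Exhaust a b c d) :
    supply r p + supply r q ≤ demand r b + demand r c + demand r d +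
      (supply r p / 2 + supply r q / 2) := by
  simp only [supply, demand]
  linarith [hd.rows hr, hd.cols hc, hd.row_ge m, hd.col_le a]

lemma two_rows_two_full (h : Facets r) (hd : Dominant r) (hr : Exhaust 0 p q m)
    (hc : Exhaust a b c d) :
    supply r p + supply r q ≤ demand r c + demand r d + ((r p a + r p b) + (r q a + r q b)) := by
  simp only [supply, demand]
  linarith [rowSum_eq (r := r) hc 0, rowSum_eq (r := r) hc p,
    rowSum_eq (r := r) hc q, rowSum_eq (r := r) hc m,
    colSum_eq (r := r) hr a, colSum_eq (r := r) hr b, colSum_eq (r := r) hr c,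
    colSum_eq (r := r) hr d,
    hd.rows hr, hd.cols hc, h.ppt' hd 0 c, h.ppt' hd 0 d, h.pos m c, h.pos m d]

lemma two_rows_two_mixed (h : Facets r) (hd : Dominant r) (hr : Exhaust 0 p q m)
    (hc : Exhaust a b c d) :
    supply r p + supply r q ≤
      demand r c + demand r d + ((r p a + r p b) + (supply r q / 2 + r q b)) := by
  simp only [supply, demand]
  linarith [rowSum_eq (r := r) hc 0, rowSum_eq (r := r) hc p,
    rowSum_eq (r := r) hc q, rowSum_eq (r := r) hc m,
    colSum_eq (r := r) hr a, colSum_eq (r := r) hr b, colSum_eq (r := r) hr c,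
    colSum_eq (r := r) hr d,
    hd.rows hr, hd.cols hc, h.ppt' hd p a, h.col_pair m 0 b hr.2.2.1.symm]

lemma two_rows_two_trunc (h : Facets r) (hd : Dominant r) (hr : Exhaust 0 p q m)
    (hc : Exhaust a b c d) :
    supply r p + supply r q ≤ demand r c + demand r d +
      ((supply r p / 2 + r p b) + (supply r q / 2 + r q b)) := by
  simp only [supply, demand]
  linarith [rowSum_eq (r := r) hc 0, rowSum_eq (r := r) hc p,
    rowSum_eq (r := r) hc q, rowSum_eq (r := r) hc m,
    colSum_eq (r := r) hr a, colSum_eq (r := r) hr b, colSum_eq (r := r) hr c,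
    colSum_eq (r := r) hr d,
    hd.rows hr, hd.cols hc, hd.col_le a, h.col_pair m 0 b hr.2.2.1.symm]

/-- The suffix `ne` marks the case in which the two rows are truncated in different columns. -/
lemma two_rows_two_trunc_ne (h : Facets r) (hd : Dominant r) (hr : Exhaust 0 p q m)
    (hc : Exhaust a b c d) :
    supply r p + supply r q ≤ demand r c + demand r d +
      ((supply r p / 2 + r p b) + (supply r q / 2 + r q a)) := by
  simp only [supply, demand]
  linarith [rowSum_eq (r := r) hc 0, rowSum_eq (r := r) hc p,
    rowSum_eq (r := r) hc q, rowSum_eq (r := r) hc m,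
    colSum_eq (r := r) hr a, colSum_eq (r := r) hr b, colSum_eq (r := r) hr c,
    colSum_eq (r := r) hr d,
    hd.rows hr, hd.cols hc, h.ppt' hd p b, h.ppt' hd q a]

lemma two_rows_three_full (h : Facets r) (hd : Dominant r) (hr : Exhaust 0 p q m)
    (hc : Exhaust a b c d) :
    supply r p + supply r q ≤ demand r d +
      ((r p a + r p b + r p c) + (r q a + r q b + r q c)) := by
  simp only [supply, demand]
  linarith [rowSum_eq (r := r) hc 0, rowSum_eq (r := r) hc p,
    rowSum_eq (r := r) hc q, rowSum_eq (r := r) hc m,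
    colSum_eq (r := r) hr a, colSum_eq (r := r) hr b, colSum_eq (r := r) hr c,
    colSum_eq (r := r) hr d,
    hd.rows hr, hd.cols hc, h.pos m d, h.ppt' hd 0 a, h.ppt' hd 0 b, h.ppt' hd 0 c, h.ppt' hd 0 d]

lemma two_rows_three_mixed (h : Facets r) (hd : Dominant r) (hr : Exhaust 0 p q m)
    (hc : Exhaust a b c d) :
    supply r p + supply r q ≤ demand r d +
      ((r p a + r p b + r p c) + (supply r q / 2 + (r q b + r q c))) := by
  simp only [supply, demand]
  linarith [rowSum_eq (r := r) hc 0, rowSum_eq (r := r) hc p,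
    rowSum_eq (r := r) hc q, rowSum_eq (r := r) hc m,
    colSum_eq (r := r) hr a, colSum_eq (r := r) hr b, colSum_eq (r := r) hr c,
    colSum_eq (r := r) hr d,
    hd.rows hr, hd.cols hc, h.pos m d, h.col_pair q 0 a hr.2.1.symm, h.ppt' hd 0 a, h.ppt' hd 0 d]

lemma two_rows_three_trunc (h : Facets r) (hd : Dominant r) (hr : Exhaust 0 p q m)
    (hc : Exhaust a b c d) :
    supply r p + supply r q ≤ demand r d +
      ((supply r p / 2 + (r p b + r p c)) + (supply r q / 2 + (r q b + r q c))) := by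
  simp only [supply, demand]
  linarith [rowSum_eq (r := r) hc 0, rowSum_eq (r := r) hc p,
    rowSum_eq (r := r) hc q, rowSum_eq (r := r) hc m,
    colSum_eq (r := r) hr a, colSum_eq (r := r) hr b, colSum_eq (r := r) hr c,
    colSum_eq (r := r) hr d,
    hd.rows hr, hd.cols hc, h.pos m d, h.ppt' hd m a, h.ppt' hd 0 a, h.ppt' hd 0 d]

lemma two_rows_three_trunc_ne (h : Facets r) (hd : Dominant r) (hr : Exhaust 0 p q m)
    (hc : Exhaust a b c d) :
    supply r p + supply r q ≤ demand r d +
      ((supply r p / 2 + (r p b + r p c)) + (supply r q / 2 + (r q a + r q c))) := by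
  simp only [supply, demand]
  linarith [hd.total, hd.rows hr, hd.cols hc, h.path 0 p q m b c a d hr hc.swap₁₂.swap₂₃]

lemma all_rows_full (h : Facets r) (hd : Dominant r) (hr : Exhaust 0 p q m)
    (hc : Exhaust a b c d) :
    demand r a ≤ r p a + r q a + r m a := by
  simp only [demand]
  linarith [rowSum_eq (r := r) hc 0, rowSum_eq (r := r) hc p,
    rowSum_eq (r := r) hc q, rowSum_eq (r := r) hc m,
    colSum_eq (r := r) hr a, colSum_eq (r := r) hr b, colSum_eq (r := r) hr c,
    colSum_eq (r := r) hr d,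
    hd.rows hr, hd.cols hc, h.ppt' hd 0 b, h.ppt' hd 0 c, h.ppt' hd 0 d]

lemma all_rows_trunc_one (h : Facets r) (hr : Exhaust 0 p q m) :
    demand r a ≤ r p a + r q a + supply r m / 2 := by
  simp only [supply, demand]
  linarith [colSum_eq (r := r) hr a, h.col_pair m 0 a hr.2.2.1.symm]

lemma all_rows_trunc_two (h : Facets r) (hd : Dominant r) (hr : Exhaust 0 p q m) :
    demand r a ≤ r p a + supply r q / 2 + supply r m / 2 := by
  simp only [supply, demand]
  linarith [hd.rows hr, h.ppt' hd p a]

lemma all_rows_trunc_three (hd : Dominant r) (hr : Exhaust 0 p q m) :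
    demand r a ≤ supply r p / 2 + supply r q / 2 + supply r m / 2 := by
  simp only [supply, demand]
  linarith [hd.rows hr, hd.col_le a]

/-- The shapes of a set of columns and of its complement. -/
lemma exists_exhaust : ∀ A : Finset (Fin 4), ∃ a b c d, Exhaust a b c d ∧
    (A = ∅ ∧ Aᶜ = Finset.univ ∨ A = {a} ∧ Aᶜ = {b, c, d} ∨ A = {a, b} ∧ Aᶜ = {c, d} ∨
      A = {a, b, c} ∧ Aᶜ = {d} ∨ A = Finset.univ ∧ Aᶜ = ∅) := by
  decide

lemma Exhaust.sum_three (hc : Exhaust a b c d) (f : Fin 4 → ℝ) :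
    ∑ j ∈ {a, b, c}, f j = f a + f b + f c := by
  rw [Finset.sum_insert (by simp [hc.1, hc.2.1]), Finset.sum_pair hc.2.2.2.1, add_assoc]

lemma Exhaust.sum_three' (hc : Exhaust a b c d) (f : Fin 4 → ℝ) :
    ∑ j ∈ {b, c, d}, f j = f b + f c + f d := by
  rw [Finset.sum_insert (by simp [hc.2.2.2.1, hc.2.2.2.2.1]), Finset.sum_pair hc.2.2.2.2.2,
    add_assoc]

/-- Two truncated entries already cover the supply of the row, so at most one truncation has to be
considered. -/
lemma capacity_cases (h : Facets r) (hd : Dominant r) (p : Fin 4) (A : Finset (Fin 4)) :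
    supply r p ≤ ∑ j ∈ A, capacity r p j ∨ ∑ j ∈ A, capacity r p j = ∑ j ∈ A, r p j ∨
      ∃ j₀ ∈ A, ∑ j ∈ A, capacity r p j = supply r p / 2 + (∑ j ∈ A, r p j - r p j₀) := by
  have := sum_min_cases A (r p) (supply r p / 2) (h.pos p) (by linarith [supply_nonneg hd p])
  rwa [mul_div_cancel₀ _ two_ne_zero] at this

end Cuts

end

/-! ### Cut conditions and solvability of the transport problem. -/

section

section Cuts

variable {r : Matrix (Fin 4) (Fin 4) ℝ} {p q m a b c d : Fin 4}

lemma one_row_cut (h : Facets r) (hd : Dominant r) (hr : Exhaust 0 p q m)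
    (A : Finset (Fin 4)) :
    supply r p ≤ ∑ j ∈ Aᶜ, demand r j + ∑ j ∈ A, capacity r p j := by
  have h0 : 0 ≤ ∑ j ∈ Aᶜ, demand r j := Finset.sum_nonneg fun j _ => demand_nonneg hd j
  obtain ⟨a, b, c, d, hc, hA⟩ := exists_exhaust A
  rcases capacity_cases h hd p A with h1 | h1 | ⟨j₀, hj₀, h1⟩
  · linarith
  · rw [h1]
    rcases hA with ⟨hA, hA'⟩ | ⟨hA, hA'⟩ | ⟨hA, hA'⟩ | ⟨hA, hA'⟩ | ⟨hA, hA'⟩ <;> rw [hA', hA]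
    · rw [hc.sum_eq, sum_demand hd hr hc, Finset.sum_empty]
      linarith [supply_nonneg hd q, supply_nonneg hd m]
    · rw [hc.sum_three', Finset.sum_singleton]
      exact one_row_one_full h hd hc
    · rw [Finset.sum_pair hc.2.2.2.2.2, Finset.sum_pair hc.1]
      exact one_row_two_full h hd hc
    · rw [hc.sum_three, Finset.sum_singleton]
      exact one_row_three_full h hd hr hc
    · rw [hc.sum_eq, Finset.sum_empty, zero_add]
      exact one_row_four_full h hd hr hc
  · rw [h1]
    rcases hA with ⟨hA, hA'⟩ | ⟨hA, hA'⟩ | ⟨hA, hA'⟩ | ⟨hA, hA'⟩ | ⟨hA, hA'⟩ <;>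
      rw [hA', hA] <;> rw [hA] at hj₀
    · simp at hj₀
    · obtain rfl : j₀ = a := by simpa using hj₀
      rw [hc.sum_three', Finset.sum_singleton]
      linarith [one_row_one_trunc hd hc (p := p)]
    · rw [Finset.sum_pair hc.2.2.2.2.2, Finset.sum_pair hc.1]
      obtain rfl | rfl : j₀ = a ∨ j₀ = b := by simpa using hj₀
      · linarith [one_row_two_trunc h hd hc (p := p)]
      · linarith [one_row_two_trunc h hd hc.swap₁₂ (p := p)]
    · rw [hc.sum_three, Finset.sum_singleton]
      obtain rfl | rfl | rfl : j₀ = a ∨ j₀ = b ∨ j₀ = c := by simpa using hj₀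
      · linarith [one_row_three_trunc h hc (p := p)]
      · linarith [one_row_three_trunc h hc.swap₁₂ (p := p)]
      · linarith [one_row_three_trunc h hc.swap₂₃.swap₁₂ (p := p)]
    · rw [hc.sum_eq, Finset.sum_empty, zero_add]
      have hj₁ : j₀ = a ∨ j₀ = b ∨ j₀ = c ∨ j₀ = d := by
        have := Finset.mem_univ j₀; rw [hc.univ_eq] at this; simpa using this
      obtain rfl | rfl | rfl | rfl := hj₁
      · linarith [one_row_four_trunc h hd hr hc]
      · linarith [one_row_four_trunc h hd hr hc.swap₁₂]
      · linarith [one_row_four_trunc h hd hr hc.swap₂₃.swap₁₂]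
      · linarith [one_row_four_trunc h hd hr hc.swap₃₄.swap₂₃.swap₁₂]

/-- A row whose capacities cover its own supply can be dropped, which leaves `one_row_cut` for the
other row. Otherwise each row is full or truncated once, and every combination has a certificate up
to relabelling. -/
lemma two_rows_cut (h : Facets r) (hd : Dominant r) (hr : Exhaust 0 p q m)
    (A : Finset (Fin 4)) :
    supply r p + supply r q ≤
      ∑ j ∈ Aᶜ, demand r j + (∑ j ∈ A, capacity r p j + ∑ j ∈ A, capacity r q j) := by
  have hr' : Exhaust 0 q p m := hr.swap₂₃
  obtain ⟨a, b, c, d, hc, hA⟩ := exists_exhaust A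
  have hp := one_row_cut h hd hr A
  have hq := one_row_cut h hd hr' A
  rcases capacity_cases h hd p A with h1 | h1
  · linarith
  rcases capacity_cases h hd q A with h2 | h2
  · linarith
  rcases hA with ⟨hA, hA'⟩ | ⟨hA, hA'⟩ | ⟨hA, hA'⟩ | ⟨hA, hA'⟩ | ⟨hA, hA'⟩
  · rw [hA', hA, hc.sum_eq, sum_demand hd hr hc]
    simp only [Finset.sum_empty]
    linarith [supply_nonneg hd m]
  · rw [hA', hc.sum_three']
    simp only [hA, Finset.sum_singleton, Finset.mem_singleton, exists_eq_left] at h1 h2 ⊢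
    rcases h1 with h1 | h1 <;> rcases h2 with h2 | h2 <;> rw [h1, h2]
    · exact two_rows_one_full h hd hr hc
    · linarith [two_rows_one_mixed h hd hr hc]
    · linarith [two_rows_one_mixed h hd hr' hc]
    · linarith [two_rows_one_trunc hd hr hc]
  · rw [hA', Finset.sum_pair hc.2.2.2.2.2]
    simp only [hA, Finset.sum_pair hc.1, Finset.mem_insert, Finset.mem_singleton,
      exists_eq_or_imp, exists_eq_left] at h1 h2 ⊢
    rcases h1 with h1 | h1 | h1 <;> rcases h2 with h2 | h2 | h2 <;> rw [h1, h2]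
    · exact two_rows_two_full h hd hr hc
    · linarith [two_rows_two_mixed h hd hr hc]
    · linarith [two_rows_two_mixed h hd hr hc.swap₁₂]
    · linarith [two_rows_two_mixed h hd hr' hc]
    · linarith [two_rows_two_trunc h hd hr hc]
    · linarith [two_rows_two_trunc_ne h hd hr hc]
    · linarith [two_rows_two_mixed h hd hr' hc.swap₁₂]
    · linarith [two_rows_two_trunc_ne h hd hr hc.swap₁₂]
    · linarith [two_rows_two_trunc h hd hr hc.swap₁₂]
  · rw [hA', Finset.sum_singleton]
    simp only [hA, hc.sum_three, Finset.mem_insert, Finset.mem_singleton,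
      exists_eq_or_imp, exists_eq_left] at h1 h2 ⊢
    have hc₂ := hc.swap₁₂
    have hc₃ := hc.swap₂₃.swap₁₂
    rcases h1 with h1 | h1 | h1 | h1 <;> rcases h2 with h2 | h2 | h2 | h2 <;> rw [h1, h2]
    · exact two_rows_three_full h hd hr hc
    · linarith [two_rows_three_mixed h hd hr hc]
    · linarith [two_rows_three_mixed h hd hr hc₂]
    · linarith [two_rows_three_mixed h hd hr hc₃]
    · linarith [two_rows_three_mixed h hd hr' hc]
    · linarith [two_rows_three_trunc h hd hr hc]
    · linarith [two_rows_three_trunc_ne h hd hr hc]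
    · linarith [two_rows_three_trunc_ne h hd hr hc.swap₂₃]
    · linarith [two_rows_three_mixed h hd hr' hc₂]
    · linarith [two_rows_three_trunc_ne h hd hr hc₂]
    · linarith [two_rows_three_trunc h hd hr hc₂]
    · linarith [two_rows_three_trunc_ne h hd hr hc₂.swap₂₃]
    · linarith [two_rows_three_mixed h hd hr' hc₃]
    · linarith [two_rows_three_trunc_ne h hd hr hc₃]
    · linarith [two_rows_three_trunc_ne h hd hr hc₃.swap₂₃]
    · linarith [two_rows_three_trunc h hd hr hc₃]
  · rw [hA', Finset.sum_empty] at hp hq ⊢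
    linarith

/-- With all rows in the cut, total supply equals total demand, so the condition becomes a sum over
the columns of `A` and can be checked column by column. -/
lemma demand_le_capacity (h : Facets r) (hd : Dominant r) (hr : Exhaust 0 p q m) (j : Fin 4) :
    demand r j ≤ capacity r p j + capacity r q j + capacity r m j := by
  obtain ⟨a, b, c, hc⟩ : ∃ a b c, Exhaust j a b c := by revert j; decide
  have hr₁ : Exhaust 0 p m q := hr.swap₃₄
  have hr₂ : Exhaust 0 q m p := hr.swap₂₃.swap₃₄
  unfold capacity
  rcases min_choice (r p j) (supply r p / 2) with h1 | h1 <;>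
    rcases min_choice (r q j) (supply r q / 2) with h2 | h2 <;>
    rcases min_choice (r m j) (supply r m / 2) with h3 | h3 <;> rw [h1, h2, h3]
  · exact all_rows_full h hd hr hc
  · exact all_rows_trunc_one h hr
  · linarith [all_rows_trunc_one h hr₁ (a := j)]
  · exact all_rows_trunc_two h hd hr
  · linarith [all_rows_trunc_one h hr₂ (a := j)]
  · linarith [all_rows_trunc_two h hd hr.swap₂₃ (a := j)]
  · linarith [all_rows_trunc_two h hd hr₂.swap₂₃ (a := j)]
  · exact all_rows_trunc_three hd hr

lemma capacity_cut (h : Facets r) (hd : Dominant r) (I : Finset (Fin 3)) (A : Finset (Fin 4)) :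
    ∑ k ∈ I, supply r k.succ ≤
      ∑ j ∈ Aᶜ, demand r j + ∑ k ∈ I, ∑ j ∈ A, capacity r k.succ j := by
  have hI : I = ∅ ∨ (∃ k, I = {k}) ∨ (∃ k k', k ≠ k' ∧ I = {k, k'}) ∨ I = Finset.univ := by
    revert I; decide
  have hr₁ : ∀ k : Fin 3, ∃ q m, Exhaust 0 k.succ q m := by decide
  have hr₂ : ∀ k k' : Fin 3, k ≠ k' → ∃ m, Exhaust 0 k.succ k'.succ m := by decide
  rcases hI with rfl | ⟨k, rfl⟩ | ⟨k, k', hk, rfl⟩ | rfl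
  · simpa using Finset.sum_nonneg fun j _ => demand_nonneg hd j
  · obtain ⟨q, m, hr⟩ := hr₁ k
    simpa using one_row_cut h hd hr A
  · obtain ⟨m, hr⟩ := hr₂ k k' hk
    rw [Finset.sum_pair hk, Finset.sum_pair hk]
    exact two_rows_cut h hd hr A
  · have hr : Exhaust 0 (0 : Fin 3).succ (1 : Fin 3).succ (2 : Fin 3).succ := by decide
    have hc : Exhaust 0 1 2 3 := by decide
    have h1 := Finset.sum_le_sum fun j (_ : j ∈ A) => demand_le_capacity h hd hr j
    have h2 := Finset.sum_add_sum_compl A (demand r)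
    rw [hc.sum_eq, sum_demand hd hr hc] at h2
    simp only [Finset.sum_add_distrib] at h1
    rw [Fin.sum_univ_three, Fin.sum_univ_three]
    linarith

/-- The transport problem of a matrix which satisfies the facet inequalities is solvable. -/
theorem exists_transport_of_facets (h : Facets r) (hd : Dominant r) :
    ∃ y : Fin 3 → Fin 4 → ℝ, (∀ k j, 0 ≤ y k j) ∧ (∀ k j, y k j ≤ capacity r k.succ j) ∧
      (∀ k, ∑ j, y k j = supply r k.succ) ∧ ∀ j, ∑ k, y k j = demand r j := by
  have hr : Exhaust 0 (0 : Fin 3).succ (1 : Fin 3).succ (2 : Fin 3).succ := by decide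
  have hc : Exhaust 0 1 2 3 := by decide
  obtain ⟨y, h0, h1, h2, h3⟩ := exists_transport (fun (k : Fin 3) j => capacity r k.succ j)
    (fun k => supply r k.succ) (demand r) (fun k j => capacity_nonneg h hd k.succ j)
    (by rw [Fin.sum_univ_three, hc.sum_eq, sum_demand hd hr hc]) (capacity_cut h hd)
  exact ⟨y, h0, h1, h2, h3⟩

end Cuts

end

/-! ### Decomposition of a dominant matrix into permuted `D0` and `G0`. -/

/-- The cone over the polytope `P_s`. -/
def coneOverPs : Set (Matrix (Fin 4) (Fin 4) ℝ) :=
  {M | ∃ t : ℝ, 0 ≤ t ∧ ∃ P ∈ polytopePs, M = t • P}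

lemma D0_apply (i j : Fin 4) : D0 i j = if i = j then 1 / 4 else 0 := by
  fin_cases i <;> fin_cases j <;> simp [D0]

lemma G0_apply (i j : Fin 4) :
    G0 i j = if (i = 0 ∨ i = 1) ∧ (j = 0 ∨ j = 1) then 1 / 4 else 0 := by
  fin_cases i <;> fin_cases j <;> simp [G0]

lemma D0_submatrix_mem (σ τ : Equiv.Perm (Fin 4)) : D0.submatrix σ τ ∈ polytopePs :=
  subset_convexHull ℝ _ ⟨σ, τ, .inl rfl⟩

lemma G0_submatrix_mem (σ τ : Equiv.Perm (Fin 4)) : G0.submatrix σ τ ∈ polytopePs :=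
  subset_convexHull ℝ _ ⟨σ, τ, .inr rfl⟩

lemma smul_mem_coneOverPs {t : ℝ} (ht : 0 ≤ t) {M : Matrix (Fin 4) (Fin 4) ℝ}
    (hM : M ∈ coneOverPs) : t • M ∈ coneOverPs := by
  obtain ⟨s, hs, P, hP, rfl⟩ := hM
  exact ⟨t * s, mul_nonneg ht hs, P, hP, (mul_smul _ _ _).symm⟩

lemma zero_mem_coneOverPs : (0 : Matrix (Fin 4) (Fin 4) ℝ) ∈ coneOverPs :=
  ⟨0, le_rfl, _, D0_submatrix_mem 1 1, (zero_smul _ _).symm⟩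

lemma add_mem_coneOverPs {M N : Matrix (Fin 4) (Fin 4) ℝ} (hM : M ∈ coneOverPs)
    (hN : N ∈ coneOverPs) : M + N ∈ coneOverPs := by
  obtain ⟨s, hs, P, hP, rfl⟩ := hM
  obtain ⟨t, ht, Q, hQ, rfl⟩ := hN
  rcases (add_nonneg hs ht).eq_or_lt with h | h
  · have hs0 : s = 0 := by linarith
    have ht0 : t = 0 := by linarith
    simpa [hs0, ht0] using zero_mem_coneOverPs
  · refine ⟨s + t, h.le, _, convex_convexHull ℝ _ hP hQ (div_nonneg hs h.le)
      (div_nonneg ht h.le) (by field_simp), ?_⟩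
    rw [smul_add, smul_smul, smul_smul, mul_div_cancel₀ _ h.ne', mul_div_cancel₀ _ h.ne']

lemma sum_mem_coneOverPs {ι : Type*} (A : Finset ι) (f : ι → Matrix (Fin 4) (Fin 4) ℝ)
    (hf : ∀ i ∈ A, f i ∈ coneOverPs) : ∑ i ∈ A, f i ∈ coneOverPs :=
  Finset.sum_induction f (· ∈ coneOverPs) (fun _ _ => add_mem_coneOverPs) zero_mem_coneOverPs hf

lemma entrySum_submatrix (M : Matrix (Fin 4) (Fin 4) ℝ) (σ τ : Equiv.Perm (Fin 4)) :
    entrySum (M.submatrix σ τ) = entrySum M := by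
  unfold entrySum
  simp only [Matrix.submatrix_apply]
  rw [Equiv.sum_comp σ fun i => ∑ j, M i (τ j)]
  exact Finset.sum_congr rfl fun i _ => Equiv.sum_comp τ (M i)

lemma entrySum_add (M N : Matrix (Fin 4) (Fin 4) ℝ) :
    entrySum (M + N) = entrySum M + entrySum N := by
  simp [entrySum, Finset.sum_add_distrib]

lemma entrySum_smul (t : ℝ) (M : Matrix (Fin 4) (Fin 4) ℝ) :
    entrySum (t • M) = t * entrySum M := by
  simp [entrySum, Finset.mul_sum]

lemma entrySum_D0 : entrySum D0 = 1 := by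
  simp [entrySum, D0_apply]

lemma entrySum_G0 : entrySum G0 = 1 := by
  simp [entrySum, G0, Fin.sum_univ_four]
  norm_num

lemma nonneg_and_entrySum_of_mem {M : Matrix (Fin 4) (Fin 4) ℝ} (hM : M ∈ polytopePs) :
    (∀ i j, 0 ≤ M i j) ∧ entrySum M = 1 := by
  refine convexHull_min (t := {M | (∀ i j, 0 ≤ M i j) ∧ entrySum M = 1}) ?_ ?_ hM
  · rintro _ ⟨σ, τ, rfl | rfl⟩
    · refine ⟨fun i j => ?_, by rw [entrySum_submatrix, entrySum_D0]⟩
      rw [Matrix.submatrix_apply, D0_apply]; split_ifs <;> norm_num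
    · refine ⟨fun i j => ?_, by rw [entrySum_submatrix, entrySum_G0]⟩
      rw [Matrix.submatrix_apply, G0_apply]; split_ifs <;> norm_num
  · rintro M ⟨hM, hM'⟩ N ⟨hN, hN'⟩ a b ha hb hab
    refine ⟨fun i j => ?_, by rw [entrySum_add, entrySum_smul, entrySum_smul, hM', hN']; linarith⟩
    exact add_nonneg (mul_nonneg ha (hM i j)) (mul_nonneg hb (hN i j))

/-- All points of `P_s` have entry sum one, so the scaling factor must be one. Decompositions can
thus be made in the cone without tracking weights. -/
lemma mem_polytopePs_of_cone {M : Matrix (Fin 4) (Fin 4) ℝ} (hM : M ∈ coneOverPs)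
    (h1 : entrySum M = 1) : M ∈ polytopePs := by
  obtain ⟨t, -, P, hP, rfl⟩ := hM
  rw [entrySum_smul, (nonneg_and_entrySum_of_mem hP).2, mul_one] at h1
  rwa [h1, one_smul]

lemma permMatrix_mem (π : Equiv.Perm (Fin 4)) : π.permMatrix ℝ ∈ coneOverPs := by
  refine ⟨4, by norm_num, _, D0_submatrix_mem π 1, ?_⟩
  ext i j
  simp [Equiv.Perm.permMatrix, PEquiv.toMatrix_apply, D0_apply, eq_comm]

/-- A nonnegative matrix all of whose row and column sums agree lies in the cone over `P_s`. -/
lemma mem_cone_of_sums_eq {M : Matrix (Fin 4) (Fin 4) ℝ} {δ : ℝ} (h0 : ∀ i j, 0 ≤ M i j)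
    (hr : ∀ i, ∑ j, M i j = δ) (hc : ∀ j, ∑ i, M i j = δ) : M ∈ coneOverPs := by
  have hδ : 0 ≤ δ := hr 0 ▸ Finset.sum_nonneg fun j _ => h0 0 j
  rcases hδ.eq_or_lt with rfl | hδ
  · have : M = 0 := by
      ext i j
      exact (Finset.sum_eq_zero_iff_of_nonneg fun j _ => h0 i j).1 (hr i) j (Finset.mem_univ j)
    exact this ▸ zero_mem_coneOverPs
  · have hM : δ⁻¹ • M ∈ doublyStochastic ℝ (Fin 4) := by
      rw [mem_doublyStochastic_iff_sum]
      refine ⟨fun i j => mul_nonneg (inv_nonneg.2 hδ.le) (h0 i j), fun i => ?_, fun j => ?_⟩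
      · simp [← Finset.mul_sum, hr, hδ.ne']
      · simp [← Finset.mul_sum, hc, hδ.ne']
    obtain ⟨w, hw, -, hw'⟩ := exists_eq_sum_perm_of_mem_doublyStochastic hM
    have hM' : M = δ • ∑ σ, w σ • σ.permMatrix ℝ := by rw [hw', smul_inv_smul₀ hδ.ne']
    rw [hM']
    exact smul_mem_coneOverPs hδ.le
      (sum_mem_coneOverPs _ _ fun σ _ => smul_mem_coneOverPs (hw σ) (permMatrix_mem σ))

/-- The matrix with rows `0` and `k` equal to `v`, and all other rows zero. -/
def twoRows (k : Fin 4) (v : Fin 4 → ℝ) : Matrix (Fin 4) (Fin 4) ℝ :=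
  Matrix.of fun i j => if i = 0 ∨ i = k then v j else 0

lemma twoRows_pair_mem {k : Fin 4} (hk : k ≠ 0) (π : Equiv.Perm (Fin 4)) :
    twoRows k (fun j => π.permMatrix ℝ 0 j + π.permMatrix ℝ 1 j) ∈ coneOverPs := by
  -- Rows 0 and 1 of a permutation matrix add up to the indicator of the columns `π 0`, `π 1`. The
  -- swap carries rows `{0, k}` to `{0, 1}`, and `π⁻¹` does the same for the columns.
  refine ⟨4, by norm_num, _, G0_submatrix_mem (Equiv.swap 1 k) π⁻¹, ?_⟩
  have h1 : ∀ i : Fin 4, (Equiv.swap 1 k i = 0 ∨ Equiv.swap 1 k i = 1) ↔ (i = 0 ∨ i = k) := by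
    revert k; decide
  have h2 : ∀ j, ¬ (π 0 = j ∧ π 1 = j) := by
    rintro j ⟨h, h'⟩
    exact absurd (π.injective (h.trans h'.symm)) (by decide)
  ext i j
  simp only [twoRows, Matrix.of_apply, Matrix.smul_apply, Matrix.submatrix_apply, G0_apply, h1,
    Equiv.Perm.permMatrix, PEquiv.toMatrix_apply, Equiv.toPEquiv_apply, Option.mem_some_iff,
    Equiv.Perm.inv_eq_iff_eq, smul_eq_mul]
  by_cases hi : i = 0 ∨ i = k
  · have := h2 j
    by_cases h3 : π 0 = j <;> by_cases h4 : π 1 = j <;> simp_all [eq_comm]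
  · simp [hi]

/-- The vectors of fixed sum with entries at most half of it form a hypersimplex with pair
indicators as vertices. Birkhoff's theorem proves this: complete two rows `v / V` by two rows `1 / 2
- v / V` to a doubly stochastic matrix and keep the top two rows of each permutation matrix. -/
lemma twoRows_mem {k : Fin 4} (hk : k ≠ 0) {v : Fin 4 → ℝ} (h0 : ∀ j, 0 ≤ v j)
    (hv : ∀ j, v j ≤ (∑ j, v j) / 2) : twoRows k v ∈ coneOverPs := by
  have hV : 0 ≤ ∑ j, v j := Finset.sum_nonneg fun j _ => h0 j
  set V := ∑ j, v j with hVdef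
  rcases hV.eq_or_lt with hV | hV
  · have : twoRows k v = 0 := by
      ext i j
      have : v j = 0 := le_antisymm (by simpa [← hV] using hv j) (h0 j)
      simp [twoRows, this]
    exact this ▸ zero_mem_coneOverPs
  · let N : Matrix (Fin 4) (Fin 4) ℝ :=
      Matrix.of fun i j => if i = 0 ∨ i = 1 then v j / V else 1 / 2 - v j / V
    have hvV : ∑ j, v j / V = 1 := by rw [← Finset.sum_div, ← hVdef, div_self hV.ne']
    have hN : N ∈ doublyStochastic ℝ (Fin 4) := by
      rw [mem_doublyStochastic_iff_sum]
      refine ⟨fun i j => ?_, fun i => ?_, fun j => ?_⟩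
      · simp only [N, Matrix.of_apply]
        split_ifs
        · exact div_nonneg (h0 j) hV.le
        · have := (div_le_iff₀ hV).2 (show v j ≤ 1 / 2 * V by linarith [hv j])
          linarith
      · simp only [N, Matrix.of_apply]
        split_ifs
        · exact hvV
        · rw [Finset.sum_sub_distrib, hvV]; norm_num
      · simp only [N, Matrix.of_apply, Fin.sum_univ_four]
        simp [show (2 : Fin 4) ≠ 1 by decide, show (3 : Fin 4) ≠ 1 by decide]
        ring
    obtain ⟨w, hw, -, hw'⟩ := exists_eq_sum_perm_of_mem_doublyStochastic hN
    have hvN : ∀ j, v j = V / 2 * (N 0 j + N 1 j) := by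
      intro j
      simp only [N, Matrix.of_apply]
      simp only [true_or, or_true, if_true]
      field_simp
      ring
    have hsum : twoRows k v = ∑ σ : Equiv.Perm (Fin 4), (V / 2 * w σ) •
        twoRows k (fun j => σ.permMatrix ℝ 0 j + σ.permMatrix ℝ 1 j) := by
      ext i j
      rw [Matrix.sum_apply]
      simp only [twoRows, Matrix.of_apply, Matrix.smul_apply, smul_eq_mul]
      by_cases hi : i = 0 ∨ i = k
      · simp only [hi, if_true]
        rw [hvN, ← hw', Matrix.sum_apply, Matrix.sum_apply, ← Finset.sum_add_distrib,
          Finset.mul_sum]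
        exact Finset.sum_congr rfl fun σ _ => by simp only [Matrix.smul_apply, smul_eq_mul]; ring
      · simp [hi]
    rw [hsum]
    exact sum_mem_coneOverPs _ _ fun σ _ =>
      smul_mem_coneOverPs (mul_nonneg (by positivity) (hw σ)) (twoRows_pair_mem hk σ)

/-- Up to symmetry, the facet inequalities define the polytope `P_s`. -/
theorem mem_polytopePs_of_dominant {r : Matrix (Fin 4) (Fin 4) ℝ} (h : Facets r)
    (hd : Dominant r) : r ∈ polytopePs := by
  obtain ⟨y, hy0, hyc, hys, hyd⟩ := exists_transport_of_facets h hd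
  have hr : Exhaust 0 1 2 3 := by decide
  have hrows := hd.rows hr
  let Γ : Matrix (Fin 4) (Fin 4) ℝ := ∑ k : Fin 3, twoRows k.succ (y k)
  have hΓ : Γ ∈ coneOverPs := by
    refine sum_mem_coneOverPs _ _ fun k _ => twoRows_mem (Fin.succ_ne_zero k) (hy0 k) fun j => ?_
    rw [hys k]
    exact (hyc k j).trans (min_le_right _ _)
  have hΓ0 : ∀ j, Γ 0 j = demand r j := by
    intro j
    simp only [Γ, Matrix.sum_apply, twoRows, Matrix.of_apply, true_or, if_true]
    exact hyd j
  have hΓs : ∀ (k : Fin 3) j, Γ k.succ j = y k j := by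
    intro k j
    simp [Γ, Matrix.sum_apply, twoRows, Fin.succ_ne_zero, Fin.succ_inj]
  -- Row 0 of the remainder is nonnegative because `demand r j ≤ r 0 j` is the facet `ppt`; the
  -- other rows use `y ≤ capacity ≤ r`.
  have hΔ : r - Γ ∈ coneOverPs := by
    refine mem_cone_of_sums_eq (δ := 1 / 2 - rowSum r 0) (fun i j => ?_) (fun i => ?_) fun j => ?_
    · rw [Matrix.sub_apply, sub_nonneg]
      refine Fin.cases ?_ (fun k => ?_) i
      · rw [hΓ0]
        unfold demand
        linarith [h.ppt' hd 0 j]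
      · rw [hΓs]
        exact (hyc k j).trans (min_le_left _ _)
    · simp only [Matrix.sub_apply, Finset.sum_sub_distrib]
      change rowSum r i - _ = _
      refine Fin.cases ?_ (fun k => ?_) i
      · simp only [hΓ0]
        rw [hr.sum_eq, sum_demand hd hr hr]
        unfold supply
        linarith
      · simp only [hΓs, hys]
        unfold supply
        ring
    · simp only [Matrix.sub_apply, Finset.sum_sub_distrib]
      change colSum r j - _ = _
      rw [Fin.sum_univ_succ, hΓ0]
      simp only [hΓs, hyd]
      unfold demand
      ring
  refine mem_polytopePs_of_cone ?_ hd.total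
  rw [← sub_add_cancel r Γ]
  exact add_mem_coneOverPs hΔ hΓ

/-! ### Correlation coefficients, their symmetries, and the reduction to the dominant case. -/

section

/-- Eigenvalues of `σ_k ⊗ σ_k` on the Bell vector `Φ_i`, where `σ_0 = 1`. -/
def bellSign : Fin 4 → Fin 4 → ℤ :=
  ![![1, 1, -1, 1], ![1, -1, 1, 1], ![1, 1, 1, -1], ![1, -1, -1, -1]]

/-- The correlation coefficients of a Bell-diagonal operator. -/
def hat (r : Matrix (Fin 4) (Fin 4) ℝ) (k l : Fin 4) : ℝ :=
  ∑ i, ∑ j, (bellSign i k : ℝ) * bellSign j l * r i j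

/-- Inequalities on the correlation coefficients satisfied by separable Bell-diagonal operators. -/
structure HatFacets (r : Matrix (Fin 4) (Fin 4) ℝ) : Prop where
  pos : ∀ i j, 0 ≤ r i j
  ppt : ∀ i j, (rowSum r i + colSum r j) / 2 - entrySum r / 4 ≤ r i j
  row_one : ∀ k : Fin 3, ∑ l : Fin 3, |hat r k.succ l.succ| +
    (∑ k' : Fin 3, |hat r k'.succ 0| - |hat r k.succ 0|) ≤ hat r 0 0
  col_one : ∀ l : Fin 3, ∑ k : Fin 3, |hat r k.succ l.succ| +
    (∑ l' : Fin 3, |hat r 0 l'.succ| - |hat r 0 l.succ|) ≤ hat r 0 0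
  row_two : ∀ k : Fin 3, (∑ k' : Fin 3, ∑ l : Fin 3, |hat r k'.succ l.succ| -
    ∑ l : Fin 3, |hat r k.succ l.succ|) + ∑ l : Fin 3, |hat r 0 l.succ| + |hat r k.succ 0| ≤
      2 * hat r 0 0
  col_two : ∀ l : Fin 3, (∑ l' : Fin 3, ∑ k : Fin 3, |hat r k.succ l'.succ| -
    ∑ k : Fin 3, |hat r k.succ l.succ|) + ∑ k : Fin 3, |hat r k.succ 0| + |hat r 0 l.succ| ≤
      2 * hat r 0 0

variable {r : Matrix (Fin 4) (Fin 4) ℝ}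

lemma rowSum_transpose (i : Fin 4) : rowSum r.transpose i = colSum r i := rfl

lemma colSum_transpose (i : Fin 4) : colSum r.transpose i = rowSum r i := rfl

lemma entrySum_transpose : entrySum r.transpose = entrySum r :=
  Finset.sum_comm (f := fun i j => r j i)

lemma hat_transpose (k l : Fin 4) : hat r.transpose k l = hat r l k := by
  unfold hat
  rw [Finset.sum_comm]
  exact Finset.sum_congr rfl fun i _ => Finset.sum_congr rfl fun j _ => by
    rw [Matrix.transpose_apply]; ring

lemma HatFacets.transpose (h : HatFacets r) : HatFacets r.transpose where
  pos i j := h.pos j i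
  ppt i j := by
    rw [rowSum_transpose, colSum_transpose, entrySum_transpose, add_comm]; exact h.ppt j i
  row_one k := by simpa only [hat_transpose] using h.col_one k
  col_one k := by simpa only [hat_transpose] using h.row_one k
  row_two k := by simpa only [hat_transpose] using h.col_two k
  col_two k := by simpa only [hat_transpose] using h.row_two k

lemma rowSum_submatrix (σ τ : Equiv.Perm (Fin 4)) (i : Fin 4) :
    rowSum (r.submatrix σ τ) i = rowSum r (σ i) := Equiv.sum_comp τ (r (σ i))

lemma colSum_submatrix (σ τ : Equiv.Perm (Fin 4)) (j : Fin 4) :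
    colSum (r.submatrix σ τ) j = colSum r (τ j) := Equiv.sum_comp σ fun i => r i (τ j)

set_option maxRecDepth 10000 in
-- The triples of nontrivial signs are vertices of a regular tetrahedron. Its symmetries act on the
-- three coordinates by signed permutations, so the absolute correlations are merely permuted.
lemma bellSign_perm : ∀ σ : Equiv.Perm (Fin 4), ∃ τ : Equiv.Perm (Fin 3), ∃ ε : Fin 3 → Bool,
    ∀ k : Fin 3, ∀ i, bellSign (σ i) k.succ = (bif ε k then 1 else -1) * bellSign i (τ k).succ := by
  decide

lemma bellSign_zero : ∀ i, bellSign i 0 = 1 := by decide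

lemma hat_submatrix (σ : Equiv.Perm (Fin 4)) (k l : Fin 4) :
    hat (r.submatrix σ id) k l =
      ∑ i, ∑ j, (bellSign (σ⁻¹ i) k : ℝ) * bellSign j l * r i j := by
  rw [← Equiv.sum_comp σ fun i => ∑ j, (bellSign (σ⁻¹ i) k : ℝ) * bellSign j l * r i j]
  simp [hat]

lemma abs_hat_submatrix (σ : Equiv.Perm (Fin 4)) : ∃ τ : Equiv.Perm (Fin 3),
    (∀ (k : Fin 3) l, |hat (r.submatrix σ id) k.succ l| = |hat r (τ k).succ l|) ∧
      ∀ l, hat (r.submatrix σ id) 0 l = hat r 0 l := by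
  obtain ⟨τ, ε, h⟩ := bellSign_perm σ⁻¹
  refine ⟨τ, fun k l => ?_, fun l => ?_⟩
  · rw [hat_submatrix]
    simp only [h]
    cases hε : ε k <;> simp [hat, neg_mul]
  · rw [hat_submatrix]
    simp only [bellSign_zero, hat]

lemma HatFacets.submatrix_left (h : HatFacets r) (σ : Equiv.Perm (Fin 4)) :
    HatFacets (r.submatrix σ id) := by
  obtain ⟨τ, h1, h2⟩ := abs_hat_submatrix (r := r) σ
  have hr : ∀ i, rowSum (r.submatrix σ id) i = rowSum r (σ i) := rowSum_submatrix σ 1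
  have hc : ∀ i, colSum (r.submatrix σ id) i = colSum r i := colSum_submatrix σ 1
  have ht : entrySum (r.submatrix σ id) = entrySum r := entrySum_submatrix r σ 1
  refine ⟨fun i j => h.pos (σ i) j, fun i j => ?_, fun k => ?_, fun l => ?_, fun k => ?_,
    fun l => ?_⟩
  · rw [hr, hc, ht]; exact h.ppt (σ i) j
  · simp only [h1, h2]
    rw [Equiv.sum_comp τ fun k => |hat r k.succ 0|]
    exact h.row_one (τ k)
  · simp only [h1, h2]
    rw [Equiv.sum_comp τ fun k => |hat r k.succ l.succ|]
    exact h.col_one l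
  · simp only [h1, h2]
    rw [Equiv.sum_comp τ fun k => ∑ l : Fin 3, |hat r k.succ l.succ|]
    exact h.row_two (τ k)
  · simp only [h1, h2]
    rw [Equiv.sum_comp τ fun k => |hat r k.succ 0|, Equiv.sum_comp τ fun k => |hat r k.succ l.succ|]
    have : ∀ l' : Fin 3, ∑ k, |hat r (τ k).succ l'.succ| = ∑ k : Fin 3, |hat r k.succ l'.succ| :=
      fun l' => Equiv.sum_comp τ fun k => |hat r k.succ l'.succ|
    simp only [this]
    exact h.col_two l

lemma HatFacets.submatrix (h : HatFacets r) (σ τ : Equiv.Perm (Fin 4)) :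
    HatFacets (r.submatrix σ τ) :=
  ((h.submatrix_left σ).transpose.submatrix_left τ).transpose

/-- The partial transpose of a Bell-diagonal operator, up to a relabelling of the Bell basis. -/
def partialTranspose (r : Matrix (Fin 4) (Fin 4) ℝ) : Matrix (Fin 4) (Fin 4) ℝ :=
  Matrix.of fun i j => entrySum r / 4 - (rowSum r i + colSum r j) / 2 + r i j

lemma rowSum_partialTranspose (i : Fin 4) :
    rowSum (partialTranspose r) i = entrySum r / 2 - rowSum r i := by
  have : ∑ j, colSum r j = entrySum r := Finset.sum_comm
  simp only [rowSum, partialTranspose, Matrix.of_apply, Finset.sum_add_distrib,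
    Finset.sum_sub_distrib, ← Finset.sum_div, this]
  simp only [Finset.sum_const, Finset.card_univ, Fintype.card_fin]
  ring

lemma colSum_partialTranspose (j : Fin 4) :
    colSum (partialTranspose r) j = entrySum r / 2 - colSum r j := by
  have : ∑ i, rowSum r i = entrySum r := rfl
  simp only [colSum, partialTranspose, Matrix.of_apply, Finset.sum_add_distrib,
    Finset.sum_sub_distrib, ← Finset.sum_div, this]
  simp only [Finset.sum_const, Finset.card_univ, Fintype.card_fin]
  ring

lemma entrySum_partialTranspose : entrySum (partialTranspose r) = entrySum r := by
  have : ∑ i, rowSum r i = entrySum r := rfl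
  change ∑ i, rowSum (partialTranspose r) i = _
  simp only [rowSum_partialTranspose, Finset.sum_sub_distrib, this]
  simp only [Finset.sum_const, Finset.card_univ, Fintype.card_fin]
  ring

lemma partialTranspose_partialTranspose : partialTranspose (partialTranspose r) = r := by
  ext i j
  rw [partialTranspose, Matrix.of_apply, rowSum_partialTranspose, colSum_partialTranspose,
    entrySum_partialTranspose, partialTranspose, Matrix.of_apply]
  ring

/-- Only coefficients with exactly one zero index change sign, so the bounds on absolute values are
unaffected by `partialTranspose`. -/
lemma hat_partialTranspose (k l : Fin 4) : hat (partialTranspose r) k l =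
    (if k = 0 then 1 else -1) * (if l = 0 then 1 else -1) * hat r k l := by
  simp only [hat, partialTranspose, rowSum, colSum, entrySum, Fin.sum_univ_four, Matrix.of_apply]
  fin_cases k <;> fin_cases l <;> simp [bellSign] <;> ring

/-- The conditions `pos` and `ppt` are exchanged. -/
lemma HatFacets.partialTranspose (h : HatFacets r) : HatFacets (partialTranspose r) := by
  have h00 : hat (FourQubit.partialTranspose r) 0 0 = hat r 0 0 := by simp [hat_partialTranspose]
  have ha : ∀ k l, |hat (FourQubit.partialTranspose r) k l| = |hat r k l| := by
    intro k l
    rw [hat_partialTranspose]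
    split_ifs <;> simp
  refine ⟨fun i j => ?_, fun i j => ?_, fun k => ?_, fun l => ?_, fun k => ?_, fun l => ?_⟩
  · have := h.ppt i j
    simp only [FourQubit.partialTranspose, Matrix.of_apply]
    linarith
  · rw [rowSum_partialTranspose, colSum_partialTranspose, entrySum_partialTranspose]
    have := h.pos i j
    simp only [FourQubit.partialTranspose, Matrix.of_apply]
    linarith
  · simpa only [h00, ha] using h.row_one k
  · simpa only [h00, ha] using h.col_one l
  · simpa only [h00, ha] using h.row_two k
  · simpa only [h00, ha] using h.col_two l

lemma hat_le_abs (r : Matrix (Fin 4) (Fin 4) ℝ) (k l : Fin 4) :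
    -|hat r k l| ≤ hat r k l ∧ hat r k l ≤ |hat r k l| := ⟨neg_abs_le _, le_abs_self _⟩

lemma HatFacets.col_pair_zero (h : HatFacets r) :
    r 0 0 + r 1 0 ≤ (rowSum r 0 + colSum r 0) / 2 := by
  have h1 := h.row_one 2
  simp only [Fin.sum_univ_three, show (0 : Fin 3).succ = (1 : Fin 4) from rfl,
    show (1 : Fin 3).succ = (2 : Fin 4) from rfl, show (2 : Fin 3).succ = (3 : Fin 4) from rfl] at h1
  -- One choice of signs in the absolute-value bound; in terms of the entries of `r` it is the
  -- required facet.
  have h2 : 0 ≤ hat r 0 0 + hat r 1 0 - hat r 2 0 - hat r 3 1 + hat r 3 2 - hat r 3 3 := by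
    linarith [hat_le_abs r 1 0, hat_le_abs r 2 0, hat_le_abs r 3 1, hat_le_abs r 3 2,
      hat_le_abs r 3 3]
  simp [hat, bellSign, Fin.sum_univ_four] at h2
  simp only [rowSum, colSum, Fin.sum_univ_four]
  linarith

lemma HatFacets.path_zero (h : HatFacets r) :
    entrySum r / 4 - (rowSum r 2 + colSum r 3) / 2 ≤ r 0 0 + r 0 1 + r 1 1 + r 1 2 := by
  have h1 := h.col_two 0
  simp only [Fin.sum_univ_three, show (0 : Fin 3).succ = (1 : Fin 4) from rfl,
    show (1 : Fin 3).succ = (2 : Fin 4) from rfl, show (2 : Fin 3).succ = (3 : Fin 4) from rfl] at h1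
  -- Again one choice of signs, now in the ten-term bound. Row and column permutations give every
  -- other `path` inequality.
  have h2 : 0 ≤ 2 * hat r 0 0 + hat r 1 0 + hat r 2 0 + hat r 3 0 - hat r 0 1
      - hat r 1 2 + hat r 2 2 + hat r 3 2 + hat r 1 3 - hat r 2 3 + hat r 3 3 := by
    linarith [hat_le_abs r 1 0, hat_le_abs r 2 0, hat_le_abs r 3 0, hat_le_abs r 0 1,
      hat_le_abs r 1 2, hat_le_abs r 2 2, hat_le_abs r 3 2, hat_le_abs r 1 3, hat_le_abs r 2 3,
      hat_le_abs r 3 3]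
  simp [hat, bellSign, Fin.sum_univ_four] at h2
  simp only [rowSum, colSum, entrySum, Fin.sum_univ_four]
  linarith

lemma exists_perm_pair : ∀ i i' : Fin 4, i ≠ i' →
    ∃ σ : Equiv.Perm (Fin 4), σ 0 = i ∧ σ 1 = i' := by
  decide

lemma exists_perm_of_exhaust {a b c d : Fin 4} (h : Exhaust a b c d) :
    ∃ σ : Equiv.Perm (Fin 4), σ 0 = a ∧ σ 1 = b ∧ σ 2 = c ∧ σ 3 = d := by
  have hinj : Function.Injective ![a, b, c, d] := by
    revert a b c d; decide
  exact ⟨Equiv.ofBijective _ (Finite.injective_iff_bijective.1 hinj), rfl, rfl, rfl, rfl⟩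

lemma HatFacets.col_pair (h : HatFacets r) (i i' j : Fin 4) (hi : i ≠ i') :
    r i j + r i' j ≤ (rowSum r i + colSum r j) / 2 := by
  obtain ⟨σ, rfl, rfl⟩ := exists_perm_pair i i' hi
  have := (h.submatrix σ (Equiv.swap 0 j)).col_pair_zero
  simpa [rowSum_submatrix, colSum_submatrix] using this

lemma HatFacets.facets (h : HatFacets r) : Facets r where
  pos := h.pos
  ppt := h.ppt
  col_pair := h.col_pair
  row_pair i j j' hj := by
    have := h.transpose.col_pair j j' i hj
    rwa [rowSum_transpose, colSum_transpose, add_comm (colSum r j)] at this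
  path z i i' p j j' j'' q hr hc := by
    obtain ⟨σ, rfl, rfl, rfl, rfl⟩ := exists_perm_of_exhaust hr.swap₁₂.swap₂₃.swap₃₄
    obtain ⟨τ, rfl, rfl, rfl, rfl⟩ := exists_perm_of_exhaust hc
    have := (h.submatrix σ τ).path_zero
    simpa [rowSum_submatrix, colSum_submatrix, entrySum_submatrix] using this

/-- A linear map which preserves the generators of the polytope `P_s` preserves `P_s`. -/
lemma map_mem_polytopePs (f : Matrix (Fin 4) (Fin 4) ℝ →ₗ[ℝ] Matrix (Fin 4) (Fin 4) ℝ)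
    (hD : ∀ σ τ : Equiv.Perm (Fin 4), f (D0.submatrix σ τ) ∈ polytopePs)
    (hG : ∀ σ τ : Equiv.Perm (Fin 4), f (G0.submatrix σ τ) ∈ polytopePs) {r}
    (h : r ∈ polytopePs) : f r ∈ polytopePs := by
  refine convexHull_min (t := f ⁻¹' polytopePs) ?_
    ((convex_convexHull ℝ _).linear_preimage f) h
  rintro _ ⟨σ, τ, rfl | rfl⟩
  exacts [hD σ τ, hG σ τ]

lemma submatrix_mem_polytopePs (h : r ∈ polytopePs) (σ τ : Equiv.Perm (Fin 4)) :
    r.submatrix σ τ ∈ polytopePs :=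
  map_mem_polytopePs
    { toFun := fun r => r.submatrix σ τ, map_add' := fun _ _ => rfl, map_smul' := fun _ _ => rfl }
    (fun σ' τ' => D0_submatrix_mem (σ' * σ) (τ' * τ))
    (fun σ' τ' => G0_submatrix_mem (σ' * σ) (τ' * τ)) h

lemma D0_transpose : D0.transpose = D0 := by
  ext i j; simp [D0_apply, eq_comm]

lemma G0_transpose : G0.transpose = G0 := by
  ext i j; simp [G0_apply, and_comm]

lemma transpose_mem_polytopePs (h : r ∈ polytopePs) : r.transpose ∈ polytopePs :=
  map_mem_polytopePs
    { toFun := fun r => r.transpose, map_add' := fun _ _ => rfl, map_smul' := fun _ _ => rfl }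
    (fun σ τ => by
      change (D0.submatrix σ τ).transpose ∈ _
      rw [Matrix.transpose_submatrix, D0_transpose]; exact D0_submatrix_mem τ σ)
    (fun σ τ => by
      change (G0.submatrix σ τ).transpose ∈ _
      rw [Matrix.transpose_submatrix, G0_transpose]; exact G0_submatrix_mem τ σ) h

lemma partialTranspose_submatrix (σ τ : Equiv.Perm (Fin 4)) :
    partialTranspose (r.submatrix σ τ) = (partialTranspose r).submatrix σ τ := by
  ext i j
  simp [partialTranspose, rowSum_submatrix, colSum_submatrix, entrySum_submatrix]

lemma partialTranspose_D0 : partialTranspose D0 = D0 := by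
  have hr : ∀ i, rowSum D0 i = 1 / 4 := fun i => by simp [rowSum, D0_apply]
  have hc : ∀ i, colSum D0 i = 1 / 4 := fun i => by simp [colSum, D0_apply]
  ext i j
  simp only [partialTranspose, Matrix.of_apply, hr, hc, entrySum_D0]
  ring

/-- The block on indices `{0, 1}` moves to the block on `{2, 3}`, which is what adding 2 does to the
indices. -/
lemma partialTranspose_G0 :
    partialTranspose G0 = G0.submatrix (Equiv.addRight (2 : Fin 4)) (Equiv.addRight (2 : Fin 4)) := by
  ext i j
  simp only [partialTranspose, Matrix.of_apply, entrySum_G0]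
  fin_cases i <;> fin_cases j <;> simp [rowSum, colSum, Fin.sum_univ_four, G0]

lemma partialTranspose_mem_polytopePs (h : r ∈ polytopePs) :
    partialTranspose r ∈ polytopePs :=
  map_mem_polytopePs
    { toFun := partialTranspose
      map_add' := fun M N => by
        ext i j
        simp [partialTranspose, rowSum, colSum, entrySum, Finset.sum_add_distrib]; ring
      map_smul' := fun t M => by
        ext i j
        simp [partialTranspose, rowSum, colSum, entrySum, ← Finset.mul_sum]; ring }
    (fun σ τ => by
      change partialTranspose _ ∈ _
      rw [partialTranspose_submatrix, partialTranspose_D0]; exact D0_submatrix_mem σ τ)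
    (fun σ τ => by
      change partialTranspose _ ∈ _
      rw [partialTranspose_submatrix, partialTranspose_G0]
      exact G0_submatrix_mem (Equiv.addRight (2 : Fin 4) * σ) (Equiv.addRight (2 : Fin 4) * τ)) h

/-- If the deviation of a row sum from the mean is maximal and positive, `r` lies in `P_s`. -/
lemma HatFacets.mem_of_row_max (h : HatFacets r) (ht : entrySum r = 1) (i₀ : Fin 4)
    (hr : ∀ i, |rowSum r i - 1 / 4| ≤ rowSum r i₀ - 1 / 4)
    (hc : ∀ j, |colSum r j - 1 / 4| ≤ rowSum r i₀ - 1 / 4) : r ∈ polytopePs := by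
  have hmem : r.submatrix (Equiv.swap 0 i₀) (1 : Equiv.Perm (Fin 4)) ∈ polytopePs := by
    refine mem_polytopePs_of_dominant (h.submatrix _ 1).facets ⟨?_, fun i => ?_, fun j => ?_,
      fun i => ?_, fun j => ?_⟩
    · rw [entrySum_submatrix, ht]
    all_goals
      simp only [rowSum_submatrix, colSum_submatrix, Equiv.swap_apply_left, Equiv.Perm.one_apply]
    · linarith [(abs_le.1 (hr (Equiv.swap 0 i₀ i))).2]
    · linarith [(abs_le.1 (hc j)).2]
    · linarith [(abs_le.1 (hr (Equiv.swap 0 i₀ i))).1]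
    · linarith [(abs_le.1 (hc j)).1]
  have := submatrix_mem_polytopePs hmem (Equiv.swap 0 i₀) 1
  rw [Matrix.submatrix_submatrix] at this
  convert this
  ext i j
  simp

/-- Partial transposition negates each deviation from 1/4 and preserves both `HatFacets` and `P_s`,
so the extremal deviation may be taken nonnegative. -/
lemma HatFacets.mem_of_row_abs_max (h : HatFacets r) (ht : entrySum r = 1) (i₀ : Fin 4)
    (hr : ∀ i, |rowSum r i - 1 / 4| ≤ |rowSum r i₀ - 1 / 4|)
    (hc : ∀ j, |colSum r j - 1 / 4| ≤ |rowSum r i₀ - 1 / 4|) : r ∈ polytopePs := by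
  rcases abs_choice (rowSum r i₀ - 1 / 4) with h0 | h0
  · rw [h0] at hr hc
    exact h.mem_of_row_max ht i₀ hr hc
  · rw [← partialTranspose_partialTranspose (r := r)]
    have e : ∀ x : ℝ, 1 / 2 - x - 1 / 4 = -(x - 1 / 4) := fun x => by ring
    refine partialTranspose_mem_polytopePs (h.partialTranspose.mem_of_row_max
      (entrySum_partialTranspose.trans ht) i₀ (fun i => ?_) fun j => ?_)
    · rw [rowSum_partialTranspose, rowSum_partialTranspose, ht, e, e, abs_neg, ← h0]
      exact hr i
    · rw [colSum_partialTranspose, rowSum_partialTranspose, ht, e, e, abs_neg, ← h0]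
      exact hc j

/-- The inequalities on the correlation coefficients define the polytope `P_s`. -/
theorem HatFacets.mem_polytopePs (h : HatFacets r) (ht : entrySum r = 1) : r ∈ polytopePs := by
  obtain ⟨i₀, hi₀⟩ := Finite.exists_max fun i => |rowSum r i - 1 / 4|
  obtain ⟨j₀, hj₀⟩ := Finite.exists_max fun j => |colSum r j - 1 / 4|
  rcases le_total |colSum r j₀ - 1 / 4| |rowSum r i₀ - 1 / 4| with h0 | h0
  · exact h.mem_of_row_abs_max ht i₀ hi₀ fun j => (hj₀ j).trans h0
  · have := h.transpose.mem_of_row_abs_max (entrySum_transpose.trans ht) j₀ hj₀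
      fun i => (hi₀ i).trans h0
    simpa using transpose_mem_polytopePs this

end

/-! ### Bell projectors and the symmetric states. -/

/-- The identity and the Pauli matrices. -/
def pauli : Fin 4 → Matrix (Fin 2) (Fin 2) ℂ := ![1, sigmaX, sigmaY, sigmaZ]

lemma ofReal_inv_sqrt_two_mul_self :
    ((Real.sqrt 2 : ℝ) : ℂ)⁻¹ * ((Real.sqrt 2 : ℝ) : ℂ)⁻¹ = 1 / 2 := by
  rw [← mul_inv, ← Complex.ofReal_mul, Real.mul_self_sqrt zero_le_two]
  norm_num

lemma bellVec_orthonormal (i j : Fin 4) :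
    star (bellVec i) ⬝ᵥ bellVec j = if i = j then 1 else 0 := by
  have h := ofReal_inv_sqrt_two_mul_self
  fin_cases i <;> fin_cases j <;>
    simp [bellVec, ket, dotProduct, Fintype.sum_prod_type, Fin.sum_univ_two, Pi.single_apply, h] <;>
    norm_num

lemma bellProj_eq (i : Fin 4) :
    bellProj i = (1 / 4 : ℂ) • ∑ k, (bellSign i k : ℂ) • (pauli k ⊗ₖ pauli k) := by
  have h := ofReal_inv_sqrt_two_mul_self
  ext ⟨a, b⟩ ⟨c, d⟩
  rw [bellProj, Matrix.vecMulVec_apply, Matrix.smul_apply, Matrix.sum_apply, Fin.sum_univ_four]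
  fin_cases i <;> fin_cases a <;> fin_cases b <;> fin_cases c <;> fin_cases d <;>
    simp [bellVec, ket, bellSign, pauli, sigmaX, sigmaY, sigmaZ, h] <;>
    norm_num

lemma bellProj_mul (i j : Fin 4) :
    bellProj i * bellProj j = if i = j then bellProj i else 0 := by
  rw [bellProj, bellProj, Matrix.vecMulVec_mul_vecMulVec, bellVec_orthonormal]
  split_ifs with h
  · rw [one_smul, h]
  · rw [zero_smul, Matrix.vecMulVec_zero]

lemma bellProj_trace (i : Fin 4) : (bellProj i).trace = 1 := by
  rw [bellProj, Matrix.trace_vecMulVec, dotProduct_comm, bellVec_orthonormal, if_pos rfl]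

lemma bellProj_posSemidef (i : Fin 4) : (bellProj i).PosSemidef :=
  Matrix.posSemidef_vecMulVec_self_star _

lemma sum_bellProj : ∑ i, bellProj i = 1 := by
  simp only [bellProj_eq, ← Finset.smul_sum]
  rw [Finset.sum_comm]
  simp only [← Finset.sum_smul]
  simp [Fin.sum_univ_four, bellSign, pauli, smul_smul]
  norm_num

/-- The product projector `Π_i ⊗ Π_j`. -/
def bellProd (i j : Fin 4) : Matrix Idx Idx ℂ := bellProj i ⊗ₖ bellProj j

lemma bellProd_eq_vecMulVec (i j : Fin 4) :
    bellProd i j = Matrix.vecMulVec (fun p : Idx => bellVec i p.1 * bellVec j p.2)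
      (star fun p : Idx => bellVec i p.1 * bellVec j p.2) := by
  ext p q
  simp only [bellProd, Matrix.kroneckerMap_apply, bellProj, Matrix.vecMulVec_apply, Pi.star_apply,
    star_mul']
  ring

lemma bellProd_mul (i j k l : Fin 4) :
    bellProd i j * bellProd k l = if i = k ∧ j = l then bellProd i j else 0 := by
  rw [bellProd, bellProd, ← Matrix.mul_kronecker_mul, bellProj_mul, bellProj_mul]
  by_cases h : i = k <;> by_cases h' : j = l <;> simp [h, h']

lemma bellProd_trace (i j : Fin 4) : (bellProd i j).trace = 1 := by
  rw [bellProd, Matrix.trace_kronecker, bellProj_trace, bellProj_trace, mul_one]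

lemma bellProd_posSemidef (i j : Fin 4) : (bellProd i j).PosSemidef :=
  (bellProj_posSemidef i).kronecker (bellProj_posSemidef j)

lemma kronecker_sum {ι m n : Type} [Fintype ι] (A : Matrix m m ℂ) (B : ι → Matrix n n ℂ) :
    A ⊗ₖ (∑ i, B i) = ∑ i, A ⊗ₖ B i := by
  ext p q
  simp only [Matrix.kroneckerMap_apply, Matrix.sum_apply, Finset.mul_sum]

lemma sum_kronecker {ι m n : Type} [Fintype ι] (A : ι → Matrix m m ℂ) (B : Matrix n n ℂ) :
    (∑ i, A i) ⊗ₖ B = ∑ i, A i ⊗ₖ B := by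
  ext p q
  simp only [Matrix.kroneckerMap_apply, Matrix.sum_apply, Finset.sum_mul]

lemma sum_bellProd : ∑ i, ∑ j, bellProd i j = 1 := by
  simp only [bellProd, ← kronecker_sum, ← sum_kronecker, sum_bellProj, Matrix.one_kronecker_one]

lemma trace_mul_vecMulVec_star_nonneg {n : Type} [Fintype n] {ρ : Matrix n n ℂ}
    (h : ρ.PosSemidef) (w : n → ℂ) : 0 ≤ (ρ * Matrix.vecMulVec w (star w)).trace := by
  rw [Matrix.mul_vecMulVec, Matrix.trace_vecMulVec, dotProduct_comm]
  exact h.dotProduct_mulVec_nonneg w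

lemma trace_mul_bellProd_nonneg {ρ : Matrix Idx Idx ℂ} (h : ρ.PosSemidef) (i j : Fin 4) :
    0 ≤ (ρ * bellProd i j).trace := by
  rw [bellProd_eq_vecMulVec]
  exact trace_mul_vecMulVec_star_nonneg h _

/-- The weight of an operator on the product `Π_i ⊗ Π_j`. -/
def bellCoef (ρ : Matrix Idx Idx ℂ) : Matrix (Fin 4) (Fin 4) ℝ :=
  Matrix.of fun i j => (ρ * bellProd i j).trace.re

lemma bellOp_eq (r : Matrix (Fin 4) (Fin 4) ℝ) :
    bellOp r = ∑ i, ∑ j, ((r i j : ℝ) : ℂ) • bellProd i j := rfl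

lemma bellOp_mul_bellProd (r : Matrix (Fin 4) (Fin 4) ℝ) (i j : Fin 4) :
    bellOp r * bellProd i j = ((r i j : ℝ) : ℂ) • bellProd i j := by
  simp only [bellOp_eq, Finset.sum_mul, smul_mul_assoc, bellProd_mul]
  rw [Finset.sum_eq_single i (by
      intro k _ hk; exact Finset.sum_eq_zero fun l _ => by rw [if_neg fun h => hk h.1, smul_zero])
      (by simp),
    Finset.sum_eq_single j (by
      intro l _ hl; rw [if_neg fun h => hl h.2, smul_zero]) (by simp), if_pos ⟨rfl, rfl⟩]

lemma bellCoef_bellOp (r : Matrix (Fin 4) (Fin 4) ℝ) : bellCoef (bellOp r) = r := by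
  ext i j
  rw [bellCoef, Matrix.of_apply, bellOp_mul_bellProd, Matrix.trace_smul, bellProd_trace,
    smul_eq_mul, mul_one, Complex.ofReal_re]

lemma bellOp_injective : Function.Injective bellOp :=
  Function.LeftInverse.injective bellCoef_bellOp

lemma bellOp_trace (r : Matrix (Fin 4) (Fin 4) ℝ) :
    (bellOp r).trace = ((∑ i, ∑ j, r i j : ℝ) : ℂ) := by
  simp only [bellOp_eq, Matrix.trace_sum, Matrix.trace_smul, bellProd_trace, smul_eq_mul, mul_one,
    Complex.ofReal_sum]

lemma bellOp_isState {r : Matrix (Fin 4) (Fin 4) ℝ} (h : ∀ i j, 0 ≤ r i j)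
    (h' : ∑ i, ∑ j, r i j = 1) : IsState (bellOp r) := by
  refine ⟨?_, by rw [bellOp_trace, h', Complex.ofReal_one]⟩
  exact Matrix.posSemidef_sum _ fun i _ => Matrix.posSemidef_sum _ fun j _ =>
    (bellProd_posSemidef i j).smul (Complex.zero_le_real.2 (h i j))

/-- Two Pauli matrices commute or anticommute, and the sign disappears in `σ ⊗ σ`. -/
lemma commute_bellProj_of_mem_pauliGroup (i : Fin 4) {U : Matrix.unitaryGroup (Fin 2) ℂ}
    (hU : U ∈ pauliGroup) :
    Commute (bellProj i) ((U : Matrix (Fin 2) (Fin 2) ℂ) ⊗ₖ (U : Matrix (Fin 2) (Fin 2) ℂ)) := by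
  induction hU using Subgroup.closure_induction with
  | mem U hU =>
    rw [bellProj_eq]
    refine (Commute.sum_left _ _ _ fun k _ => Commute.smul_left ?_ _).smul_left _
    have key : ∀ k l : Fin 4, Commute (pauli k ⊗ₖ pauli k) (pauli l ⊗ₖ pauli l) := fun k l => by
      rw [Commute, SemiconjBy, ← Matrix.mul_kronecker_mul, ← Matrix.mul_kronecker_mul]
      have : pauli k * pauli l = pauli l * pauli k ∨ pauli k * pauli l = -(pauli l * pauli k) := by
        fin_cases k <;> fin_cases l <;> simp [pauli, sigmaX, sigmaY, sigmaZ]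
      rcases this with h | h
      · rw [h]
      · rw [h]; ext; simp
    rcases hU with rfl | rfl | rfl
    exacts [key k 1, key k 2, key k 3]
  | one => simp
  | mul U V _ _ hU hV =>
    rw [Matrix.UnitaryGroup.mul_val, Matrix.mul_kronecker_mul]
    exact hU.mul_right hV
  | inv U _ hU =>
    -- The inverse of a unitary is its adjoint and the projector is Hermitian, so the adjoint of the
    -- relation for `U` suffices.
    have := hU.star_star
    rwa [Matrix.star_eq_conjTranspose, Matrix.star_eq_conjTranspose,
      (bellProj_posSemidef i).isHermitian.eq, Matrix.conjTranspose_kronecker] at this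

lemma bellOp_mem_symStates {r : Matrix (Fin 4) (Fin 4) ℝ} (h : ∀ i j, 0 ≤ r i j)
    (h' : ∑ i, ∑ j, r i j = 1) : bellOp r ∈ symStates := by
  refine ⟨bellOp_isState h h', fun U hU V hV => ?_⟩
  refine Commute.sum_left _ _ _ fun i _ => Commute.sum_left _ _ _ fun j _ => Commute.smul_left ?_ _
  rw [Commute, SemiconjBy, ← Matrix.mul_kronecker_mul, ← Matrix.mul_kronecker_mul,
    (commute_bellProj_of_mem_pauliGroup i hU).eq, (commute_bellProj_of_mem_pauliGroup j hV).eq]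

lemma bellProd_eq (i j : Fin 4) :
    bellProd i j = (1 / 16 : ℂ) • ∑ k, ∑ l, ((bellSign i k : ℂ) * (bellSign j l : ℂ)) •
      ((pauli k ⊗ₖ pauli k) ⊗ₖ (pauli l ⊗ₖ pauli l)) := by
  ext p q
  simp only [bellProd, bellProj_eq, Matrix.kroneckerMap_apply, Matrix.smul_apply, Matrix.sum_apply,
    smul_eq_mul]
  rw [mul_mul_mul_comm, Finset.sum_mul_sum]
  congr 1
  · norm_num
  · exact Finset.sum_congr rfl fun k _ => Finset.sum_congr rfl fun l _ => by ring

/-- The projectors are linear combinations of the operators `U ⊗ U ⊗ V ⊗ V` with which the state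
commutes. -/
lemma commute_bellProd_of_mem_symStates {ρ : Matrix Idx Idx ℂ} (h : ρ ∈ symStates)
    (i j : Fin 4) : Commute ρ (bellProd i j) := by
  have key : ∀ k : Fin 4, ∃ U ∈ pauliGroup, (U : Matrix (Fin 2) (Fin 2) ℂ) = pauli k := by
    intro k
    fin_cases k
    · exact ⟨1, pauliGroup.one_mem, rfl⟩
    · exact ⟨⟨sigmaX, sigmaX_mem⟩, Subgroup.subset_closure (by simp), rfl⟩
    · exact ⟨⟨sigmaY, sigmaY_mem⟩, Subgroup.subset_closure (by simp), rfl⟩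
    · exact ⟨⟨sigmaZ, sigmaZ_mem⟩, Subgroup.subset_closure (by simp), rfl⟩
  rw [bellProd_eq]
  refine (Commute.sum_right _ _ _ fun k _ => Commute.sum_right _ _ _ fun l _ =>
    Commute.smul_right ?_ _).smul_right _
  obtain ⟨U, hU, hU'⟩ := key k
  obtain ⟨V, hV, hV'⟩ := key l
  rw [← hU', ← hV']
  exact h.2 U hU V hV

/-- Commutation gives `ρ P = P ρ P` for each product projector `P`, and this is a multiple of `P`
because `P` has rank one. Summing over the resolution of the identity recovers `ρ`. -/
lemma eq_bellOp_bellCoef_of_mem_symStates {ρ : Matrix Idx Idx ℂ} (h : ρ ∈ symStates) :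
    ρ = bellOp (bellCoef ρ) := by
  have key : ∀ i j, ρ * bellProd i j = ((bellCoef ρ i j : ℝ) : ℂ) • bellProd i j := fun i j => by
    have h1 : ρ * bellProd i j = bellProd i j * ρ * bellProd i j := by
      rw [← (commute_bellProd_of_mem_symStates h i j).eq, mul_assoc, bellProd_mul,
        if_pos ⟨rfl, rfl⟩]
    have h2 : ∃ c : ℂ, ρ * bellProd i j = c • bellProd i j := by
      rw [h1, bellProd_eq_vecMulVec, Matrix.vecMulVec_mul, Matrix.vecMulVec_mul_vecMulVec]
      exact ⟨_, Matrix.vecMulVec_smul _ _ _⟩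
    obtain ⟨c, hc⟩ := h2
    have h3 : (ρ * bellProd i j).trace = c := by
      rw [hc, Matrix.trace_smul, bellProd_trace, smul_eq_mul, mul_one]
    have h4 : ((bellCoef ρ i j : ℝ) : ℂ) = c := by
      rw [← h3]
      exact (Complex.eq_re_of_ofReal_le (r := 0)
        (by simpa using trace_mul_bellProd_nonneg h.1.1 i j)).symm
    rw [h4, hc]
  calc ρ = ρ * ∑ i, ∑ j, bellProd i j := by rw [sum_bellProd, mul_one]
    _ = _ := by simp only [Finset.mul_sum, key, bellOp_eq]

lemma symStates_eq : symStates = bellOp '' {r : Matrix (Fin 4) (Fin 4) ℝ |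
    (∀ i j, 0 ≤ r i j) ∧ ∑ i, ∑ j, r i j = 1} := by
  apply Set.Subset.antisymm
  · intro ρ h
    have hρ := eq_bellOp_bellCoef_of_mem_symStates h
    refine ⟨bellCoef ρ, ⟨fun i j => (Complex.nonneg_iff.1 (trace_mul_bellProd_nonneg h.1.1 i j)).1,
      ?_⟩, hρ.symm⟩
    have := h.1.2
    rw [hρ, bellOp_trace] at this
    exact_mod_cast this
  · rintro _ ⟨r, ⟨h, h'⟩, rfl⟩
    exact bellOp_mem_symStates h h'

/-! ### Separability of the states given by `P_s`. -/

lemma regroup_apply (ρ : Matrix Idx Idx ℂ) (a b c d a' b' c' d' : Fin 2) :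
    regroup ρ ((a, b), (c, d)) ((a', b'), (c', d')) = ρ ((a, c), (b, d)) ((a', c'), (b', d')) := rfl

lemma regroup_kronecker (A B C D : Matrix (Fin 2) (Fin 2) ℂ) :
    regroup ((A ⊗ₖ B) ⊗ₖ (C ⊗ₖ D)) = (A ⊗ₖ C) ⊗ₖ (B ⊗ₖ D) := by
  ext ⟨⟨a, b⟩, c, d⟩ ⟨⟨a', b'⟩, c', d'⟩
  rw [regroup_apply]
  simp only [Matrix.kroneckerMap_apply]
  ring

lemma regroup_add (ρ σ : Matrix Idx Idx ℂ) : regroup (ρ + σ) = regroup ρ + regroup σ := rfl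

lemma regroup_smul {R : Type} [SMul R ℂ] (c : R) (ρ : Matrix Idx Idx ℂ) :
    regroup (c • ρ) = c • regroup ρ := rfl

lemma regroup_sum {ι : Type} [Fintype ι] (ρ : ι → Matrix Idx Idx ℂ) :
    regroup (∑ i, ρ i) = ∑ i, regroup (ρ i) := by
  ext p q
  simp only [regroup, Matrix.reindex_apply, Matrix.submatrix_apply, Matrix.sum_apply]

lemma regroup_mul (ρ σ : Matrix Idx Idx ℂ) : regroup (ρ * σ) = regroup ρ * regroup σ :=
  map_mul (Matrix.reindexAlgEquiv ℂ ℂ (Equiv.prodProdProdComm (Fin 2) (Fin 2) (Fin 2) (Fin 2))) ρ σ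

lemma regroup_conjTranspose (ρ : Matrix Idx Idx ℂ) :
    regroup ρ.conjTranspose = (regroup ρ).conjTranspose := rfl

lemma bellOp_add (r s : Matrix (Fin 4) (Fin 4) ℝ) : bellOp (r + s) = bellOp r + bellOp s := by
  simp only [bellOp_eq, Matrix.add_apply, Complex.ofReal_add, add_smul, Finset.sum_add_distrib]

lemma bellOp_smul (c : ℝ) (r : Matrix (Fin 4) (Fin 4) ℝ) : bellOp (c • r) = c • bellOp r := by
  simp only [bellOp_eq, Matrix.smul_apply, smul_eq_mul, Complex.ofReal_mul, mul_smul,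
    Finset.smul_sum, Complex.coe_smul]

lemma convex_isSeparableAB_bellOp : Convex ℝ {r | IsSeparableAB (bellOp r)} := by
  intro r hr s hs a b ha hb hab
  simp only [Set.mem_ofPred_eq, IsSeparableAB, bellOp_add, bellOp_smul, regroup_add, regroup_smul]
  exact convex_convexHull ℝ _ hr hs ha hb hab

section Separable

variable {m n : Type} [Fintype m] [Fintype n]

lemma isSeparable_kronecker {α : Matrix m m ℂ} {β : Matrix n n ℂ} (hα : IsState α)
    (hβ : IsState β) : IsSeparable (α ⊗ₖ β) :=
  subset_convexHull ℝ _ ⟨α, β, hα, hβ, rfl⟩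

lemma isSeparable_sum {ι : Type} [Fintype ι] {σ : ι → Matrix (m × n) (m × n) ℂ} {w : ℝ}
    (hw : 0 ≤ w) (hw' : Fintype.card ι * w = 1) (h : ∀ i, IsSeparable (σ i)) :
    IsSeparable (w • ∑ i, σ i) := by
  rw [Finset.smul_sum]
  exact (convex_convexHull ℝ _).sum_mem (fun _ _ => hw)
    (by rw [Finset.sum_const, Finset.card_univ, nsmul_eq_mul, hw']) fun i _ => h i

lemma IsState.conj [DecidableEq m] {α : Matrix m m ℂ} (h : IsState α) {S : Matrix m m ℂ}
    (hS : S.conjTranspose * S = 1) : IsState (S * α * S.conjTranspose) :=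
  ⟨h.1.mul_mul_conjTranspose_same S, by rw [Matrix.trace_mul_cycle, hS, one_mul, h.2]⟩

lemma IsState.kronecker {α : Matrix m m ℂ} {β : Matrix n n ℂ} (hα : IsState α) (hβ : IsState β) :
    IsState (α ⊗ₖ β) :=
  ⟨hα.1.kronecker hβ.1, by rw [Matrix.trace_kronecker, hα.2, hβ.2, mul_one]⟩

lemma IsSeparable.conj [DecidableEq m] [DecidableEq n] {σ : Matrix (m × n) (m × n) ℂ}
    (h : IsSeparable σ) {S : Matrix m m ℂ} {T : Matrix n n ℂ} (hS : S.conjTranspose * S = 1)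
    (hT : T.conjTranspose * T = 1) :
    IsSeparable ((S ⊗ₖ T) * σ * (S ⊗ₖ T).conjTranspose) := by
  refine convexHull_min (t := {σ | IsSeparable ((S ⊗ₖ T) * σ * (S ⊗ₖ T).conjTranspose)}) ?_ ?_ h
  · rintro _ ⟨α, β, hα, hβ, rfl⟩
    rw [Set.mem_ofPred_eq, Matrix.conjTranspose_kronecker, ← Matrix.mul_kronecker_mul,
      ← Matrix.mul_kronecker_mul]
    exact isSeparable_kronecker (hα.conj hS) (hβ.conj hT)
  · intro x hx y hy a b ha hb hab
    simp only [Set.mem_ofPred_eq, mul_add, add_mul, mul_smul_comm, smul_mul_assoc]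
    exact convex_convexHull ℝ _ hx hy ha hb hab

end Separable

/-- The permutation `s` of the Bell projectors is implemented by local unitaries. -/
def LocallyImplements (s : Equiv.Perm (Fin 4)) : Prop :=
  ∃ S T : Matrix (Fin 2) (Fin 2) ℂ, S.conjTranspose * S = 1 ∧ T.conjTranspose * T = 1 ∧
    ∀ i, (S ⊗ₖ T) * bellProj i * (S ⊗ₖ T).conjTranspose = bellProj (s i)

lemma locallyImplements_of_mulVec {s : Equiv.Perm (Fin 4)} (S T : Matrix (Fin 2) (Fin 2) ℂ)
    (hS : S.conjTranspose * S = 1) (hT : T.conjTranspose * T = 1) (c : Fin 4 → ℂ)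
    (hc : ∀ i, c i * star (c i) = 1)
    (h : ∀ i p, (S ⊗ₖ T).mulVec (bellVec i) p = c i * bellVec (s i) p) :
    LocallyImplements s := by
  refine ⟨S, T, hS, hT, fun i => ?_⟩
  ext p q
  rw [bellProj, Matrix.mul_vecMulVec, Matrix.vecMulVec_mul, ← Matrix.star_mulVec, bellProj,
    Matrix.vecMulVec_apply, Matrix.vecMulVec_apply, Pi.star_apply, Pi.star_apply, h, h, star_mul']
  linear_combination (bellVec (s i) p * star (bellVec (s i) q)) * hc i

lemma LocallyImplements.mul {s t : Equiv.Perm (Fin 4)} (hs : LocallyImplements s)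
    (ht : LocallyImplements t) : LocallyImplements (s * t) := by
  obtain ⟨S, T, hS, hT, h⟩ := hs
  obtain ⟨S', T', hS', hT', h'⟩ := ht
  refine ⟨S * S', T * T', ?_, ?_, fun i => ?_⟩
  · rw [Matrix.conjTranspose_mul, mul_assoc, ← mul_assoc _ S, hS, one_mul, hS']
  · rw [Matrix.conjTranspose_mul, mul_assoc, ← mul_assoc _ T, hT, one_mul, hT']
  · rw [Matrix.mul_kronecker_mul, Matrix.conjTranspose_mul, Equiv.Perm.mul_apply, ← h, ← h']
    simp only [mul_assoc]

lemma locallyImplements_one : LocallyImplements 1 :=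
  ⟨1, 1, by simp, by simp, fun i => by simp⟩

/-- Two equal phase gates give `|11⟩` the sign -1 and multiply `|01⟩`, `|10⟩` by the same phase.
With opposite phase gates `|11⟩` is fixed and the other two acquire opposite phases, which swaps the
last two Bell states. -/
lemma locallyImplements_swap_zero_one : LocallyImplements (Equiv.swap 0 1) := by
  refine locallyImplements_of_mulVec !![1, 0; 0, Complex.I] !![1, 0; 0, Complex.I] ?_ ?_
    ![1, 1, Complex.I, Complex.I] ?_ ?_
  · ext i j; fin_cases i <;> fin_cases j <;> simp [Matrix.mul_apply]
  · ext i j; fin_cases i <;> fin_cases j <;> simp [Matrix.mul_apply]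
  · intro i; fin_cases i <;> simp
  · intro i p
    fin_cases i <;> fin_cases p <;>
      simp [Matrix.mulVec, dotProduct, Fintype.sum_prod_type, bellVec, ket, Pi.single_apply,
        Equiv.swap_apply_def]

lemma locallyImplements_swap_two_three : LocallyImplements (Equiv.swap 2 3) := by
  refine locallyImplements_of_mulVec !![1, 0; 0, Complex.I] !![1, 0; 0, -Complex.I] ?_ ?_
    ![1, 1, -Complex.I, -Complex.I] ?_ ?_
  · ext i j; fin_cases i <;> fin_cases j <;> simp [Matrix.mul_apply]
  · ext i j; fin_cases i <;> fin_cases j <;> simp [Matrix.mul_apply]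
  · intro i; fin_cases i <;> simp
  · intro i p
    fin_cases i <;> fin_cases p <;>
      simp [Matrix.mulVec, dotProduct, Fintype.sum_prod_type, bellVec, ket, Pi.single_apply,
        Equiv.swap_apply_def]

/-- A Hadamard gate on each qubit interchanges `σ_x ⊗ σ_x` with `σ_z ⊗ σ_z`, hence the Bell states 1
and 2. -/
lemma locallyImplements_swap_one_two : LocallyImplements (Equiv.swap 1 2) := by
  have hc := ofReal_inv_sqrt_two_mul_self
  set c := ((Real.sqrt 2 : ℝ) : ℂ)⁻¹ with hcdef
  have hstar : (starRingEnd ℂ) c = c := by simp [hcdef]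
  have hH : (!![c, c; c, -c] : Matrix (Fin 2) (Fin 2) ℂ).conjTranspose * !![c, c; c, -c] = 1 := by
    ext i j; fin_cases i <;> fin_cases j <;>
      simp [Matrix.mul_apply, Fin.sum_univ_two, hstar, hc] <;> norm_num
  refine locallyImplements_of_mulVec !![c, c; c, -c] !![c, c; c, -c] hH hH
    ![1, 1, 1, -1] ?_ ?_
  · intro i; fin_cases i <;> simp
  · intro i p
    fin_cases i <;> fin_cases p <;>
      simp [Matrix.mulVec, dotProduct, Fintype.sum_prod_type, bellVec, ket, Pi.single_apply,
        Equiv.swap_apply_def, Fin.sum_univ_two, hc, ← hcdef] <;> ring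

lemma locallyImplements (s : Equiv.Perm (Fin 4)) : LocallyImplements s := by
  have hs : s ∈ Submonoid.closure
      (Set.range fun i : Fin 3 => Equiv.swap i.castSucc i.succ) := by
    rw [Equiv.Perm.mclosure_swap_castSucc_succ]; trivial
  induction hs using Submonoid.closure_induction with
  | mem s hs =>
    obtain ⟨i, rfl⟩ := hs
    fin_cases i
    exacts [locallyImplements_swap_zero_one, locallyImplements_swap_one_two,
      locallyImplements_swap_two_three]
  | one => exact locallyImplements_one
  | mul s t _ _ hs ht => exact hs.mul ht

lemma isSeparableAB_bellOp_submatrix {r : Matrix (Fin 4) (Fin 4) ℝ}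
    (h : IsSeparableAB (bellOp r)) (s t : Equiv.Perm (Fin 4)) :
    IsSeparableAB (bellOp (r.submatrix s t)) := by
  -- The weight `r (s i) (t j)` must travel from index `(s i, t j)` to `(i, j)`, hence the inverses.
  obtain ⟨S, T, hS, hT, h1⟩ := locallyImplements s⁻¹
  obtain ⟨S', T', hS', hT', h2⟩ := locallyImplements t⁻¹
  have key : bellOp (r.submatrix s t) = ((S ⊗ₖ T) ⊗ₖ (S' ⊗ₖ T')) * bellOp r *
      ((S ⊗ₖ T) ⊗ₖ (S' ⊗ₖ T')).conjTranspose := by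
    simp only [bellOp_eq, Finset.mul_sum, Finset.sum_mul, mul_smul_comm, smul_mul_assoc]
    refine Fintype.sum_equiv s _ _ fun i => Fintype.sum_equiv t _ _ fun j => ?_
    rw [bellProd, bellProd, Matrix.conjTranspose_kronecker (S ⊗ₖ T), ← Matrix.mul_kronecker_mul,
      ← Matrix.mul_kronecker_mul, h1, h2, Matrix.submatrix_apply]
    simp
  rw [IsSeparableAB, key, regroup_mul, regroup_mul, regroup_conjTranspose, regroup_kronecker]
  refine IsSeparable.conj h ?_ ?_
  · rw [Matrix.conjTranspose_kronecker, ← Matrix.mul_kronecker_mul, hS, hS',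
      Matrix.one_kronecker_one]
  · rw [Matrix.conjTranspose_kronecker, ← Matrix.mul_kronecker_mul, hT, hT',
      Matrix.one_kronecker_one]

lemma bellOp_D0 : bellOp D0 = (1 / 4 : ℝ) • ∑ i, bellProd i i := by
  simp [bellOp_eq, D0, Fin.sum_univ_four]

lemma sum_bellProd_diag : ∑ i, bellProd i i =
    (1 / 4 : ℂ) • ∑ k, (pauli k ⊗ₖ pauli k) ⊗ₖ (pauli k ⊗ₖ pauli k) := by
  have h : ∀ k l : Fin 4, ∑ i, (bellSign i k : ℂ) * (bellSign i l : ℂ) =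
      if k = l then 4 else 0 := by
    have : ∀ k l : Fin 4, ∑ i, bellSign i k * bellSign i l = if k = l then 4 else 0 := by decide
    intro k l
    have := congrArg (Int.cast : ℤ → ℂ) (this k l)
    push_cast at this
    exact this
  simp only [bellProd_eq]
  rw [← Finset.smul_sum, Finset.sum_comm, Finset.smul_sum, Finset.smul_sum]
  refine Finset.sum_congr rfl fun k _ => ?_
  rw [Finset.sum_comm]
  simp only [← Finset.sum_smul, h, ite_smul, zero_smul]
  rw [Finset.sum_ite_eq, if_pos (Finset.mem_univ k), smul_smul]
  norm_num

/-- The sum of the `σ_k^{⊗4}` does not depend on how the four factors are paired, so after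
regrouping it is again the sum of `Π_i ⊗ Π_i`, now across the cut. -/
lemma isSeparableAB_bellOp_D0 : IsSeparableAB (bellOp D0) := by
  have h : regroup (∑ i, bellProd i i) = ∑ i, bellProd i i := by
    rw [sum_bellProd_diag, regroup_smul, regroup_sum]
    simp only [regroup_kronecker]
  rw [IsSeparableAB, bellOp_D0, regroup_smul, h]
  exact isSeparable_sum (by norm_num) (by simp) fun i =>
    isSeparable_kronecker ⟨bellProj_posSemidef i, bellProj_trace i⟩
      ⟨bellProj_posSemidef i, bellProj_trace i⟩

/-- The projector onto a computational basis state of a qubit. -/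
def basisProj (a : Fin 2) : Matrix (Fin 2) (Fin 2) ℂ :=
  Matrix.vecMulVec (Pi.single a 1) (star (Pi.single a 1))

lemma basisProj_isState (a : Fin 2) : IsState (basisProj a) :=
  ⟨Matrix.posSemidef_vecMulVec_self_star _, by
    rw [basisProj, Matrix.trace_vecMulVec]; simp⟩

lemma bellProj_zero_add_one :
    bellProj 0 + bellProj 1 = ∑ a, basisProj a ⊗ₖ basisProj a := by
  have h := ofReal_inv_sqrt_two_mul_self
  ext ⟨a, b⟩ ⟨c, d⟩
  rw [bellProj, bellProj, Matrix.add_apply, Matrix.sum_apply]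
  fin_cases a <;> fin_cases b <;> fin_cases c <;> fin_cases d <;>
    simp [Matrix.vecMulVec_apply, basisProj, bellVec, ket, Fin.sum_univ_two, h] <;> norm_num

/-- The sum `Π_1 + Π_2` projects onto the span of `|00⟩` and `|11⟩`, so the state is a uniform
mixture of product basis states. -/
lemma isSeparableAB_bellOp_G0 : IsSeparableAB (bellOp G0) := by
  have h : bellOp G0 = (1 / 4 : ℝ) • ((bellProj 0 + bellProj 1) ⊗ₖ (bellProj 0 + bellProj 1)) := by
    simp [bellOp_eq, G0, Fin.sum_univ_four, Matrix.add_kronecker, Matrix.kronecker_add, bellProd]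
    abel
  have h' : regroup ((bellProj 0 + bellProj 1) ⊗ₖ (bellProj 0 + bellProj 1)) =
      ∑ x : Fin 2 × Fin 2, (basisProj x.1 ⊗ₖ basisProj x.2) ⊗ₖ
        (basisProj x.1 ⊗ₖ basisProj x.2) := by
    rw [bellProj_zero_add_one, sum_kronecker, regroup_sum, Fintype.sum_prod_type]
    simp only [kronecker_sum, regroup_sum, regroup_kronecker]
  rw [IsSeparableAB, h, regroup_smul, h']
  exact isSeparable_sum (by norm_num) (by simp) fun x =>
    isSeparable_kronecker ((basisProj_isState _).kronecker (basisProj_isState _))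
      ((basisProj_isState _).kronecker (basisProj_isState _))

lemma isSeparableAB_of_mem_polytopePs {r : Matrix (Fin 4) (Fin 4) ℝ} (h : r ∈ polytopePs) :
    IsSeparableAB (bellOp r) := by
  refine convexHull_min ?_ convex_isSeparableAB_bellOp h
  rintro _ ⟨s, t, rfl | rfl⟩
  · exact isSeparableAB_bellOp_submatrix isSeparableAB_bellOp_D0 s t
  · exact isSeparableAB_bellOp_submatrix isSeparableAB_bellOp_G0 s t

/-! ### Inequalities satisfied by separable states. -/

lemma trace_regroup (ρ : Matrix Idx Idx ℂ) : (regroup ρ).trace = ρ.trace :=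
  Equiv.sum_comp (Equiv.prodProdProdComm (Fin 2) (Fin 2) (Fin 2) (Fin 2)).symm fun p => ρ p p

/-- The weights on the products `Π_i ⊗ Π_j` of an operator given with its factors regrouped. -/
def abCoef (σ : Matrix (TwoQubit × TwoQubit) (TwoQubit × TwoQubit) ℂ) :
    Matrix (Fin 4) (Fin 4) ℝ :=
  Matrix.of fun i j => (σ * regroup (bellProd i j)).trace.re

lemma abCoef_regroup (ρ : Matrix Idx Idx ℂ) : abCoef (regroup ρ) = bellCoef ρ := by
  ext i j
  rw [abCoef, Matrix.of_apply, ← regroup_mul, trace_regroup]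
  rfl

lemma abCoef_regroup_bellOp (r : Matrix (Fin 4) (Fin 4) ℝ) : abCoef (regroup (bellOp r)) = r := by
  rw [abCoef_regroup, bellCoef_bellOp]

lemma abCoef_nonneg {σ : Matrix (TwoQubit × TwoQubit) (TwoQubit × TwoQubit) ℂ}
    (h : σ.PosSemidef) (i j : Fin 4) : 0 ≤ abCoef σ i j := by
  have h' : (σ.submatrix (Equiv.prodProdProdComm (Fin 2) (Fin 2) (Fin 2) (Fin 2))
      (Equiv.prodProdProdComm (Fin 2) (Fin 2) (Fin 2) (Fin 2))).PosSemidef := h.submatrix _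
  have := (Complex.nonneg_iff.1 (trace_mul_bellProd_nonneg h' i j)).1
  change 0 ≤ bellCoef _ i j at this
  rwa [← abCoef_regroup] at this

lemma abCoef_add (σ τ : Matrix (TwoQubit × TwoQubit) (TwoQubit × TwoQubit) ℂ) :
    abCoef (σ + τ) = abCoef σ + abCoef τ := by
  ext i j
  simp [abCoef, add_mul]

lemma abCoef_smul (c : ℝ) (σ : Matrix (TwoQubit × TwoQubit) (TwoQubit × TwoQubit) ℂ) :
    abCoef (c • σ) = c • abCoef σ := by
  ext i j
  simp [abCoef]

/-- The Pauli correlation of a two-qubit operator. -/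
def corr (α : Matrix TwoQubit TwoQubit ℂ) (k l : Fin 4) : ℝ :=
  (α * (pauli k ⊗ₖ pauli l)).trace.re

lemma pauli_conjTranspose (k : Fin 4) : (pauli k).conjTranspose = pauli k := by
  ext i j
  fin_cases k <;> fin_cases i <;> fin_cases j <;> simp [pauli, sigmaX, sigmaY, sigmaZ]

lemma ofReal_corr {α : Matrix TwoQubit TwoQubit ℂ} (h : α.IsHermitian) (k l : Fin 4) :
    ((corr α k l : ℝ) : ℂ) = (α * (pauli k ⊗ₖ pauli l)).trace := by
  apply Complex.conj_eq_iff_re.1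
  rw [← Complex.star_def, ← Matrix.trace_conjTranspose, Matrix.conjTranspose_mul,
    Matrix.conjTranspose_kronecker, pauli_conjTranspose, pauli_conjTranspose, h.eq,
    Matrix.trace_mul_comm]

/-- The Bell-diagonal coefficients with prescribed correlation coefficients. -/
def unhat (m : Fin 4 → Fin 4 → ℝ) : Matrix (Fin 4) (Fin 4) ℝ :=
  Matrix.of fun i j => 1 / 16 * ∑ k, ∑ l, (bellSign i k : ℝ) * bellSign j l * m k l

/-- The sign table is a Hadamard matrix of order four: `Bᵀ B = 4`. -/
lemma hat_unhat (m : Fin 4 → Fin 4 → ℝ) (k l : Fin 4) : hat (unhat m) k l = m k l := by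
  let B : Matrix (Fin 4) (Fin 4) ℝ := Matrix.of fun i k => (bellSign i k : ℝ)
  have hB : B.transpose * B = (4 : ℝ) • 1 := by
    ext k l
    fin_cases k <;> fin_cases l <;>
      simp [B, Matrix.mul_apply, Fin.sum_univ_four, bellSign] <;> norm_num
  have h1 : ∀ r k l, hat r k l = (B.transpose * r * B) k l := fun r k l => by
    simp only [Matrix.mul_apply, Finset.sum_mul, hat]
    rw [Finset.sum_comm]
    exact Finset.sum_congr rfl fun j _ => Finset.sum_congr rfl fun i _ => by
      simp only [B, Matrix.transpose_apply, Matrix.of_apply]; ring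
  have h2 : unhat m = (1 / 16 : ℝ) • (B * Matrix.of m * B.transpose) := by
    ext i j
    simp only [Matrix.mul_apply, Finset.sum_mul, unhat, Matrix.smul_apply, Matrix.of_apply,
      smul_eq_mul]
    rw [Finset.sum_comm]
    congr 1
    exact Finset.sum_congr rfl fun j _ => Finset.sum_congr rfl fun i _ => by
      simp only [B, Matrix.transpose_apply, Matrix.of_apply]; ring
  have h3 : B.transpose * unhat m * B = Matrix.of m := by
    calc B.transpose * unhat m * B
        = (1 / 16 : ℝ) • ((B.transpose * B) * Matrix.of m * (B.transpose * B)) := by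
          rw [h2, mul_smul_comm, smul_mul_assoc]; simp only [mul_assoc]
      _ = Matrix.of m := by
          rw [hB, smul_one_mul, mul_smul_comm, mul_one, smul_smul, smul_smul]
          norm_num
  rw [h1, h3, Matrix.of_apply]

/-- Regrouping turns `σ_k σ_k σ_l σ_l` into `(σ_k ⊗ σ_l) ⊗ (σ_k ⊗ σ_l)`, whose trace against `α ⊗ β`
factorises. -/
lemma abCoef_kronecker {α β : Matrix TwoQubit TwoQubit ℂ} (hα : α.IsHermitian)
    (hβ : β.IsHermitian) :
    abCoef (α ⊗ₖ β) = unhat fun k l => corr α k l * corr β k l := by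
  ext i j
  have h : ((α ⊗ₖ β) * regroup (bellProd i j)).trace =
      ((unhat (fun k l => corr α k l * corr β k l) i j : ℝ) : ℂ) := by
    rw [bellProd_eq, regroup_smul, regroup_sum]
    simp only [regroup_sum, regroup_smul, regroup_kronecker, mul_smul_comm, Finset.mul_sum,
      Matrix.trace_smul, Matrix.trace_sum, ← Matrix.mul_kronecker_mul, Matrix.trace_kronecker,
      unhat, Matrix.of_apply, smul_eq_mul]
    push_cast
    simp only [ofReal_corr hα, ofReal_corr hβ]
  rw [abCoef, Matrix.of_apply, h, Complex.ofReal_re]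

lemma hat_abCoef_kronecker {α β : Matrix TwoQubit TwoQubit ℂ} (hα : α.IsHermitian)
    (hβ : β.IsHermitian) (k l : Fin 4) :
    hat (abCoef (α ⊗ₖ β)) k l = corr α k l * corr β k l := by
  rw [abCoef_kronecker hα hβ, hat_unhat]

lemma corr_transpose (β : Matrix TwoQubit TwoQubit ℂ) (k l : Fin 4) :
    corr β.transpose k l =
      (![1, 1, -1, 1] : Fin 4 → ℝ) k * (![1, 1, -1, 1] : Fin 4 → ℝ) l * corr β k l := by
  have h : ∀ k, (pauli k).transpose = (![1, 1, -1, 1] : Fin 4 → ℝ) k • pauli k := by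
    intro k
    ext i j
    fin_cases k <;> fin_cases i <;> fin_cases j <;> simp [pauli, sigmaX, sigmaY, sigmaZ]
  have h' : (pauli k ⊗ₖ pauli l).transpose = ((![1, 1, -1, 1] : Fin 4 → ℝ) k *
      (![1, 1, -1, 1] : Fin 4 → ℝ) l) • (pauli k ⊗ₖ pauli l) := by
    rw [← Matrix.kroneckerMap_transpose, h, h, Matrix.smul_kronecker, Matrix.kronecker_smul,
      smul_smul]
  rw [corr, ← Matrix.trace_transpose, Matrix.transpose_mul, Matrix.transpose_transpose, h',
    smul_mul_assoc, Matrix.trace_smul, Matrix.trace_mul_comm, Complex.smul_re, smul_eq_mul, corr]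

/-- This justifies the name `partialTranspose` and, since `βᵀ` is again positive semidefinite,
yields the `ppt` inequalities on product states. -/
lemma partialTranspose_abCoef_kronecker {α β : Matrix TwoQubit TwoQubit ℂ} (hα : α.IsHermitian)
    (hβ : β.IsHermitian) (i j : Fin 4) :
    partialTranspose (abCoef (α ⊗ₖ β)) i j = abCoef (α ⊗ₖ β.transpose) i.rev j.rev := by
  have hβ' : β.transpose.IsHermitian := hβ.transpose
  rw [abCoef_kronecker hα hβ, abCoef_kronecker hα hβ']
  simp only [corr_transpose]
  set m := fun k l => corr α k l * corr β k l with hm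
  have e : ∀ k l, ∀ s : ℝ, corr α k l * (s * corr β k l) = s * m k l := fun k l s => by
    rw [hm]; ring
  simp only [e]
  clear_value m
  have hs : ∀ l : Fin 4, (∑ j, (bellSign j l : ℝ)) = if l = 0 then 4 else 0 := by
    have : ∀ l : Fin 4, ∑ j, bellSign j l = if l = 0 then 4 else 0 := by decide
    intro l
    have := congrArg (Int.cast : ℤ → ℝ) (this l)
    push_cast at this
    exact this
  have hrow : ∀ i, rowSum (unhat m) i = 1 / 4 * ∑ k, (bellSign i k : ℝ) * m k 0 := fun i => by
    calc rowSum (unhat m) i = ∑ j, 1 / 16 * ∑ k, ∑ l, (bellSign i k : ℝ) * bellSign j l * m k l :=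
          rfl
      _ = 1 / 16 * ∑ k, ∑ l, (bellSign i k : ℝ) * m k l * ∑ j, (bellSign j l : ℝ) := by
        rw [← Finset.mul_sum, Finset.sum_comm]
        refine congrArg _ (Finset.sum_congr rfl fun k _ => ?_)
        rw [Finset.sum_comm]
        refine Finset.sum_congr rfl fun l _ => ?_
        rw [Finset.mul_sum]
        exact Finset.sum_congr rfl fun j _ => by ring
      _ = _ := by
        simp only [hs, mul_ite, mul_zero, Finset.sum_ite_eq', Finset.mem_univ, if_true]
        rw [← Finset.sum_mul]; ring
  have hcol : ∀ j, colSum (unhat m) j = 1 / 4 * ∑ l, (bellSign j l : ℝ) * m 0 l := fun j => by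
    calc colSum (unhat m) j = ∑ i, 1 / 16 * ∑ k, ∑ l, (bellSign i k : ℝ) * bellSign j l * m k l :=
          rfl
      _ = 1 / 16 * ∑ k, ∑ l, (bellSign j l : ℝ) * m k l * ∑ i, (bellSign i k : ℝ) := by
        rw [← Finset.mul_sum, Finset.sum_comm]
        refine congrArg _ (Finset.sum_congr rfl fun k _ => ?_)
        rw [Finset.sum_comm]
        refine Finset.sum_congr rfl fun l _ => ?_
        rw [Finset.mul_sum]
        exact Finset.sum_congr rfl fun j _ => by ring
      _ = _ := by
        rw [Finset.sum_comm]
        simp only [hs, mul_ite, mul_zero, Finset.sum_ite_eq', Finset.mem_univ, if_true]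
        rw [← Finset.sum_mul]; ring
  have hsum : entrySum (unhat m) = m 0 0 := by
    rw [← hat_unhat m 0 0]; simp [hat, entrySum, bellSign_zero]
  -- Transposition negates the `σ_y` sign. Reversing the Bell labels, the effect of `σ_y` on one
  -- qubit, negates the signs of `σ_x` and `σ_z`. Together they negate all nontrivial signs.
  have hrev : ∀ i k : Fin 4, (bellSign i.rev k : ℝ) * (![1, 1, -1, 1] : Fin 4 → ℝ) k =
      2 * (if k = 0 then 1 else 0) - bellSign i k := by
    have h : ∀ i k : Fin 4, bellSign i.rev k * (![1, 1, -1, 1] : Fin 4 → ℤ) k =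
      2 * (if k = 0 then 1 else 0) - bellSign i k := by decide
    intro i k
    have := congrArg (Int.cast : ℤ → ℝ) (h i k)
    push_cast at this
    rw [← this]
    congr 1
    fin_cases k <;> simp
  have hR : unhat (fun k l => (![1, 1, -1, 1] : Fin 4 → ℝ) k * (![1, 1, -1, 1] : Fin 4 → ℝ) l *
      m k l) i.rev j.rev = 1 / 16 * ∑ k, ∑ l, (2 * (if k = 0 then 1 else 0) - (bellSign i k : ℝ)) *
        (2 * (if l = 0 then 1 else 0) - bellSign j l) * m k l := by
    simp only [unhat, Matrix.of_apply, ← hrev]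
    exact congrArg _ (Finset.sum_congr rfl fun k _ => Finset.sum_congr rfl fun l _ => by ring)
  rw [hR]
  change entrySum (unhat m) / 4 - (rowSum (unhat m) i + colSum (unhat m) j) / 2 + unhat m i j = _
  rw [hrow, hcol, hsum, unhat, Matrix.of_apply]
  simp [Fin.sum_univ_four, bellSign_zero]
  ring

open scoped MatrixOrder in
lemma exists_sum_vecMulVec {α : Matrix TwoQubit TwoQubit ℂ} (h : α.PosSemidef) :
    ∃ x : TwoQubit → TwoQubit → ℂ, α = ∑ i, Matrix.vecMulVec (x i) (star (x i)) := by
  obtain ⟨B, rfl⟩ := CStarAlgebra.nonneg_iff_eq_star_mul_self.mp h.nonneg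
  refine ⟨fun i => star (B i), ?_⟩
  ext p q
  simp only [Matrix.mul_apply, Matrix.sum_apply, Matrix.vecMulVec_apply, Matrix.star_apply,
    Pi.star_apply, star_star]

/-- The Pauli correlations of the pure state with the given unnormalized state vector. -/
def pureCorr (x : TwoQubit → ℂ) : Fin 4 → Fin 4 → ℝ :=
  corr (Matrix.vecMulVec x (star x))

/-- Explicit real coordinates, in which the quadratic identities for pure states become polynomial
identities. -/
lemma pureCorr_eq (x : TwoQubit → ℂ) : pureCorr x =
    let n : TwoQubit → ℝ := fun p => (x p).re ^ 2 + (x p).im ^ 2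
    let R : TwoQubit → TwoQubit → ℝ := fun p q => (x p).re * (x q).re + (x p).im * (x q).im
    let J : TwoQubit → TwoQubit → ℝ := fun p q => (x p).re * (x q).im - (x p).im * (x q).re
    ![![n (0, 0) + n (0, 1) + n (1, 0) + n (1, 1), 2 * R (0, 0) (0, 1) + 2 * R (1, 0) (1, 1),
        2 * J (0, 0) (0, 1) + 2 * J (1, 0) (1, 1), n (0, 0) - n (0, 1) + n (1, 0) - n (1, 1)],
      ![2 * R (0, 0) (1, 0) + 2 * R (0, 1) (1, 1), 2 * R (0, 0) (1, 1) + 2 * R (0, 1) (1, 0),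
        2 * J (0, 0) (1, 1) - 2 * J (0, 1) (1, 0), 2 * R (0, 0) (1, 0) - 2 * R (0, 1) (1, 1)],
      ![2 * J (0, 0) (1, 0) + 2 * J (0, 1) (1, 1), 2 * J (0, 0) (1, 1) + 2 * J (0, 1) (1, 0),
        2 * R (0, 1) (1, 0) - 2 * R (0, 0) (1, 1), 2 * J (0, 0) (1, 0) - 2 * J (0, 1) (1, 1)],
      ![n (0, 0) + n (0, 1) - n (1, 0) - n (1, 1), 2 * R (0, 0) (0, 1) - 2 * R (1, 0) (1, 1),
        2 * J (0, 0) (0, 1) - 2 * J (1, 0) (1, 1), n (0, 0) - n (0, 1) - n (1, 0) + n (1, 1)]] := by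
  ext k l
  fin_cases k <;> fin_cases l <;>
    simp [pureCorr, corr, pauli, sigmaX, sigmaY, sigmaZ, Matrix.trace, Matrix.mul_apply,
      Fintype.sum_prod_type, Fin.sum_univ_two, Matrix.vecMulVec_apply, Matrix.one_apply] <;>
    ring

lemma hat_add (r s : Matrix (Fin 4) (Fin 4) ℝ) (k l : Fin 4) :
    hat (r + s) k l = hat r k l + hat s k l := by
  simp only [hat, Matrix.add_apply, mul_add, Finset.sum_add_distrib]

lemma hat_smul (c : ℝ) (r : Matrix (Fin 4) (Fin 4) ℝ) (k l : Fin 4) :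
    hat (c • r) k l = c * hat r k l := by
  simp only [hat, Matrix.smul_apply, smul_eq_mul, Finset.mul_sum]
  exact Finset.sum_congr rfl fun i _ => Finset.sum_congr rfl fun j _ => by ring

lemma corr_sum {ι : Type} [Fintype ι] (α : ι → Matrix TwoQubit TwoQubit ℂ) (k l : Fin 4) :
    corr (∑ i, α i) k l = ∑ i, corr (α i) k l := by
  simp only [corr, Finset.sum_mul, Matrix.trace_sum, Complex.re_sum]

lemma sum_mul_abs_le {ι : Type} [Fintype ι] {w a b : ι → ℝ} (hw : ∀ i, 0 ≤ w i) {c A B : ℝ}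
    (hA : 0 ≤ A) (hB : 0 ≤ B) (hc : 0 ≤ c) (ha : ∑ i, w i * a i ^ 2 = c * A ^ 2)
    (hb : ∑ i, w i * b i ^ 2 = c * B ^ 2) : ∑ i, w i * |a i * b i| ≤ c * (A * B) := by
  refine abs_le_of_sq_le_sq' ?_ (by positivity) |>.2
  calc (∑ i, w i * |a i * b i|) ^ 2
      = (∑ i, (√(w i) * |a i|) * (√(w i) * |b i|)) ^ 2 := by
        congr 1
        refine Finset.sum_congr rfl fun i _ => ?_
        rw [mul_mul_mul_comm, Real.mul_self_sqrt (hw i), abs_mul]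
    _ ≤ (∑ i, (√(w i) * |a i|) ^ 2) * ∑ i, (√(w i) * |b i|) ^ 2 :=
        Finset.sum_mul_sq_le_sq_mul_sq _ _ _
    _ = (c * (A * B)) ^ 2 := by
        simp only [mul_pow, Real.sq_sqrt (hw _), sq_abs, ha, hb]
        ring

/-- The bound is preserved by convex combinations, so product states suffice, and these split into
products of unnormalised pure states. There `hat` is a product of correlations, and weighted
Cauchy–Schwarz applies. -/
lemma hat_bound_of_isSeparable {w : Fin 4 × Fin 4 → ℝ} (hw : ∀ p, 0 ≤ w p) {c : ℝ} (hc : 0 ≤ c)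
    (h : ∀ x, ∑ p, w p * pureCorr x p.1 p.2 ^ 2 = c * pureCorr x 0 0 ^ 2)
    {σ : Matrix (TwoQubit × TwoQubit) (TwoQubit × TwoQubit) ℂ} (hσ : IsSeparable σ) :
    ∑ p, w p * |hat (abCoef σ) p.1 p.2| ≤ c * hat (abCoef σ) 0 0 := by
  have h0 : ∀ x, 0 ≤ pureCorr x 0 0 := fun x => by
    rw [pureCorr_eq]
    change 0 ≤ (x (0, 0)).re ^ 2 + (x (0, 0)).im ^ 2 + ((x (0, 1)).re ^ 2 + (x (0, 1)).im ^ 2) +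
      ((x (1, 0)).re ^ 2 + (x (1, 0)).im ^ 2) + ((x (1, 1)).re ^ 2 + (x (1, 1)).im ^ 2)
    positivity
  refine convexHull_min (t := {σ | ∑ p, w p * |hat (abCoef σ) p.1 p.2| ≤ c * hat (abCoef σ) 0 0})
    ?_ ?_ hσ
  · rintro _ ⟨α, β, hα, hβ, rfl⟩
    rw [Set.mem_ofPred_eq]
    simp only [hat_abCoef_kronecker hα.1.isHermitian hβ.1.isHermitian]
    obtain ⟨x, rfl⟩ := exists_sum_vecMulVec hα.1
    obtain ⟨y, rfl⟩ := exists_sum_vecMulVec hβ.1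
    have hcorr : ∀ k l, corr (∑ i, Matrix.vecMulVec (x i) (star (x i))) k l *
        corr (∑ i, Matrix.vecMulVec (y i) (star (y i))) k l =
        ∑ i, ∑ j, pureCorr (x i) k l * pureCorr (y j) k l := fun k l => by
      rw [corr_sum, corr_sum, Finset.sum_mul_sum]
      rfl
    simp only [hcorr]
    calc ∑ p : Fin 4 × Fin 4, w p * |∑ i, ∑ j, pureCorr (x i) p.1 p.2 * pureCorr (y j) p.1 p.2|
        ≤ ∑ p : Fin 4 × Fin 4, w p * ∑ i, ∑ j,
            |pureCorr (x i) p.1 p.2 * pureCorr (y j) p.1 p.2| :=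
          Finset.sum_le_sum fun p _ => mul_le_mul_of_nonneg_left
            ((Finset.abs_sum_le_sum_abs _ _).trans
              (Finset.sum_le_sum fun i _ => Finset.abs_sum_le_sum_abs _ _)) (hw p)
      _ = ∑ i, ∑ j, ∑ p : Fin 4 × Fin 4, w p *
            |pureCorr (x i) p.1 p.2 * pureCorr (y j) p.1 p.2| := by
          simp only [Finset.mul_sum]
          rw [Finset.sum_comm]
          exact Finset.sum_congr rfl fun i _ => Finset.sum_comm
      _ ≤ ∑ i, ∑ j, c * (pureCorr (x i) 0 0 * pureCorr (y j) 0 0) :=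
          Finset.sum_le_sum fun i _ => Finset.sum_le_sum fun j _ =>
            sum_mul_abs_le hw (h0 _) (h0 _) hc (h (x i)) (h (y j))
      _ = c * ∑ i, ∑ j, pureCorr (x i) 0 0 * pureCorr (y j) 0 0 := by
          simp only [Finset.mul_sum]
  · intro σ hσ τ hτ a b ha hb _
    rw [Set.mem_ofPred_eq] at *
    simp only [abCoef_add, abCoef_smul, hat_add, hat_smul]
    calc ∑ p : Fin 4 × Fin 4, w p * |a * hat (abCoef σ) p.1 p.2 + b * hat (abCoef τ) p.1 p.2|
        ≤ ∑ p : Fin 4 × Fin 4, (a * (w p * |hat (abCoef σ) p.1 p.2|) +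
            b * (w p * |hat (abCoef τ) p.1 p.2|)) := Finset.sum_le_sum fun p _ => by
          have := mul_le_mul_of_nonneg_left (abs_add_le (a * hat (abCoef σ) p.1 p.2)
            (b * hat (abCoef τ) p.1 p.2)) (hw p)
          rw [abs_mul, abs_mul, abs_of_nonneg ha, abs_of_nonneg hb] at this
          linarith
      _ = a * ∑ p, w p * |hat (abCoef σ) p.1 p.2| + b * ∑ p, w p * |hat (abCoef τ) p.1 p.2| := by
          rw [Finset.sum_add_distrib, Finset.mul_sum, Finset.mul_sum]
      _ ≤ _ := by
          linarith [mul_le_mul_of_nonneg_left hσ ha, mul_le_mul_of_nonneg_left hτ hb]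

lemma abCoef_pos_of_isSeparable {σ : Matrix (TwoQubit × TwoQubit) (TwoQubit × TwoQubit) ℂ}
    (hσ : IsSeparable σ) (i j : Fin 4) :
    0 ≤ abCoef σ i j ∧ 0 ≤ partialTranspose (abCoef σ) i j := by
  refine convexHull_min
    (t := {σ | 0 ≤ abCoef σ i j ∧ 0 ≤ partialTranspose (abCoef σ) i j}) ?_ ?_ hσ
  · rintro _ ⟨α, β, hα, hβ, rfl⟩
    refine ⟨abCoef_nonneg (hα.1.kronecker hβ.1) i j, ?_⟩
    rw [partialTranspose_abCoef_kronecker hα.1.isHermitian hβ.1.isHermitian]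
    exact abCoef_nonneg (hα.1.kronecker hβ.1.transpose) _ _
  · rintro σ ⟨h1, h2⟩ τ ⟨h3, h4⟩ a b ha hb _
    have e : partialTranspose (a • abCoef σ + b • abCoef τ) i j =
        a * partialTranspose (abCoef σ) i j + b * partialTranspose (abCoef τ) i j := by
      simp only [partialTranspose, rowSum, colSum, entrySum, Matrix.of_apply, Matrix.add_apply,
        Matrix.smul_apply, smul_eq_mul, Finset.sum_add_distrib, ← Finset.mul_sum]
      ring
    rw [Set.mem_ofPred_eq, abCoef_add, abCoef_smul, abCoef_smul, e]
    exact ⟨by simp only [Matrix.add_apply, Matrix.smul_apply, smul_eq_mul]; positivity,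
      by positivity⟩

/-- Indicator of the correlations occurring in `HatFacets.row_one`. -/
def rowOneWeight (k : Fin 3) (p : Fin 4 × Fin 4) : ℕ :=
  (![![![0, 0, 0, 0], ![0, 1, 1, 1], ![1, 0, 0, 0], ![1, 0, 0, 0]],
    ![![0, 0, 0, 0], ![1, 0, 0, 0], ![0, 1, 1, 1], ![1, 0, 0, 0]],
    ![![0, 0, 0, 0], ![1, 0, 0, 0], ![1, 0, 0, 0], ![0, 1, 1, 1]]] :
      Fin 3 → Fin 4 → Fin 4 → ℕ) k p.1 p.2

/-- Indicator of the correlations occurring in `HatFacets.row_two`. -/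
def rowTwoWeight (k : Fin 3) (p : Fin 4 × Fin 4) : ℕ :=
  (![![![0, 1, 1, 1], ![1, 0, 0, 0], ![0, 1, 1, 1], ![0, 1, 1, 1]],
    ![![0, 1, 1, 1], ![0, 1, 1, 1], ![1, 0, 0, 0], ![0, 1, 1, 1]],
    ![![0, 1, 1, 1], ![0, 1, 1, 1], ![0, 1, 1, 1], ![1, 0, 0, 0]]] :
      Fin 3 → Fin 4 → Fin 4 → ℕ) k p.1 p.2

lemma sum_rowOneWeight (k : Fin 3) (f : Fin 4 → Fin 4 → ℝ) :
    ∑ p, (rowOneWeight k p : ℝ) * f p.1 p.2 =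
      ∑ l : Fin 3, f k.succ l.succ + (∑ k' : Fin 3, f k'.succ 0 - f k.succ 0) := by
  fin_cases k <;>
    simp [rowOneWeight, Fintype.sum_prod_type, Fin.sum_univ_succ] <;> ring

lemma sum_rowTwoWeight (k : Fin 3) (f : Fin 4 → Fin 4 → ℝ) :
    ∑ p, (rowTwoWeight k p : ℝ) * f p.1 p.2 =
      (∑ k' : Fin 3, ∑ l : Fin 3, f k'.succ l.succ - ∑ l : Fin 3, f k.succ l.succ) +
        ∑ l : Fin 3, f 0 l.succ + f k.succ 0 := by
  fin_cases k <;>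
    simp [rowTwoWeight, Fintype.sum_prod_type, Fin.sum_univ_succ] <;> ring

lemma sum_prod_swap (w : Fin 4 × Fin 4 → ℝ) (f : Fin 4 → Fin 4 → ℝ) :
    ∑ p : Fin 4 × Fin 4, w p.swap * f p.1 p.2 = ∑ p, w p * f p.2 p.1 :=
  (Equiv.sum_comp (Equiv.prodComm (Fin 4) (Fin 4)) fun p => w p * f p.2 p.1)

/-- The five operators `σ_k ⊗ σ_l` and `σ_k' ⊗ 1` with `k' ≠ k` anticommute pairwise, and a pure
two-qubit state saturates the resulting bound on their squared expectations. -/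
lemma pureCorr_row_one (x : TwoQubit → ℂ) (k : Fin 3) :
    ∑ l : Fin 3, pureCorr x k.succ l.succ ^ 2 +
      (∑ k' : Fin 3, pureCorr x k'.succ 0 ^ 2 - pureCorr x k.succ 0 ^ 2) =
        1 * pureCorr x 0 0 ^ 2 := by
  rw [pureCorr_eq]
  fin_cases k <;> simp [Fin.sum_univ_succ] <;> ring

lemma pureCorr_col_one (x : TwoQubit → ℂ) (l : Fin 3) :
    ∑ k : Fin 3, pureCorr x k.succ l.succ ^ 2 +
      (∑ l' : Fin 3, pureCorr x 0 l'.succ ^ 2 - pureCorr x 0 l.succ ^ 2) =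
        1 * pureCorr x 0 0 ^ 2 := by
  rw [pureCorr_eq]
  fin_cases l <;> simp [Fin.sum_univ_succ] <;> ring

/-- For a pure state the sixteen squared correlations add up to four times the squared norm term.
Removing the trivial one and the five of `pureCorr_row_one` leaves these ten, hence the factor 2. -/
lemma pureCorr_row_two (x : TwoQubit → ℂ) (k : Fin 3) :
    (∑ k' : Fin 3, ∑ l : Fin 3, pureCorr x k'.succ l.succ ^ 2 -
      ∑ l : Fin 3, pureCorr x k.succ l.succ ^ 2) + ∑ l : Fin 3, pureCorr x 0 l.succ ^ 2 +
        pureCorr x k.succ 0 ^ 2 = 2 * pureCorr x 0 0 ^ 2 := by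
  rw [pureCorr_eq]
  fin_cases k <;> simp [Fin.sum_univ_succ] <;> ring

lemma pureCorr_col_two (x : TwoQubit → ℂ) (l : Fin 3) :
    (∑ l' : Fin 3, ∑ k : Fin 3, pureCorr x k.succ l'.succ ^ 2 -
      ∑ k : Fin 3, pureCorr x k.succ l.succ ^ 2) + ∑ k : Fin 3, pureCorr x k.succ 0 ^ 2 +
        pureCorr x 0 l.succ ^ 2 = 2 * pureCorr x 0 0 ^ 2 := by
  rw [pureCorr_eq]
  fin_cases l <;> simp [Fin.sum_univ_succ] <;> ring

lemma hatFacets_of_isSeparable {σ : Matrix (TwoQubit × TwoQubit) (TwoQubit × TwoQubit) ℂ}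
    (hσ : IsSeparable σ) : HatFacets (abCoef σ) where
  pos i j := (abCoef_pos_of_isSeparable hσ i j).1
  ppt i j := by
    have := (abCoef_pos_of_isSeparable hσ i j).2
    simp only [partialTranspose, Matrix.of_apply] at this
    linarith
  row_one k := by
    have := hat_bound_of_isSeparable (w := fun p => rowOneWeight k p)
      (fun p => Nat.cast_nonneg _) zero_le_one (fun x =>
      (sum_rowOneWeight k fun k l => pureCorr x k l ^ 2).trans (pureCorr_row_one x k)) hσ
    rwa [sum_rowOneWeight k fun k l => |hat (abCoef σ) k l|, one_mul] at this
  row_two k := by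
    have := hat_bound_of_isSeparable (w := fun p => rowTwoWeight k p)
      (fun p => Nat.cast_nonneg _) zero_le_two (fun x =>
      (sum_rowTwoWeight k fun k l => pureCorr x k l ^ 2).trans (pureCorr_row_two x k)) hσ
    rwa [sum_rowTwoWeight k fun k l => |hat (abCoef σ) k l|] at this
  col_one l := by
    have := hat_bound_of_isSeparable (w := fun p => rowOneWeight l p.swap)
      (fun p => Nat.cast_nonneg _) zero_le_one (fun x =>
      ((sum_prod_swap (fun p => rowOneWeight l p) fun k l => pureCorr x k l ^ 2).trans
        (sum_rowOneWeight l fun k l => pureCorr x l k ^ 2)).trans (pureCorr_col_one x l)) hσ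
    rwa [sum_prod_swap (fun p => rowOneWeight l p) fun k l => |hat (abCoef σ) k l|,
      sum_rowOneWeight l fun k l => |hat (abCoef σ) l k|, one_mul] at this
  col_two l := by
    have := hat_bound_of_isSeparable (w := fun p => rowTwoWeight l p.swap)
      (fun p => Nat.cast_nonneg _) zero_le_two (fun x =>
      ((sum_prod_swap (fun p => rowTwoWeight l p) fun k l => pureCorr x k l ^ 2).trans
        (sum_rowTwoWeight l fun k l => pureCorr x l k ^ 2)).trans (pureCorr_col_two x l)) hσ
    rwa [sum_prod_swap (fun p => rowTwoWeight l p) fun k l => |hat (abCoef σ) k l|,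
      sum_rowTwoWeight l fun k l => |hat (abCoef σ) l k|] at this

lemma mem_polytopePs_of_isSeparableAB {r : Matrix (Fin 4) (Fin 4) ℝ} (hr : entrySum r = 1)
    (h : IsSeparableAB (bellOp r)) : r ∈ polytopePs := by
  have := hatFacets_of_isSeparable h
  rw [abCoef_regroup_bellOp] at this
  exact this.mem_polytopePs hr

end FourQubit

end

theorem mainTheorem2 :
    FourQubit.symStates =
        FourQubit.bellOp '' {r : Matrix (Fin 4) (Fin 4) ℝ |
          (∀ i j, 0 ≤ r i j) ∧ ∑ i, ∑ j, r i j = 1} ∧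
      Function.Injective FourQubit.bellOp ∧
      (∀ r : Matrix (Fin 4) (Fin 4) ℝ, FourQubit.bellOp r ∈ FourQubit.symStates →
        (FourQubit.IsSeparableAB (FourQubit.bellOp r) ↔ r ∈ FourQubit.polytopePs)) ∧
      {ρ : Matrix FourQubit.Idx FourQubit.Idx ℂ |
          ρ ∈ FourQubit.symStates ∧ FourQubit.IsSeparableAB ρ} =
        FourQubit.bellOp '' FourQubit.polytopePs := by
  have hsum : ∀ r, FourQubit.bellOp r ∈ FourQubit.symStates → FourQubit.entrySum r = 1 := by
    intro r hr
    rw [FourQubit.symStates_eq] at hr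
    obtain ⟨s, hs, hsr⟩ := hr
    rw [← FourQubit.bellOp_injective hsr]
    exact hs.2
  have hmem : ∀ r ∈ FourQubit.polytopePs, FourQubit.bellOp r ∈ FourQubit.symStates :=
    fun r hr => FourQubit.bellOp_mem_symStates (FourQubit.nonneg_and_entrySum_of_mem hr).1
      (FourQubit.nonneg_and_entrySum_of_mem hr).2
  refine ⟨FourQubit.symStates_eq, FourQubit.bellOp_injective, fun r hr =>
    ⟨FourQubit.mem_polytopePs_of_isSeparableAB (hsum r hr),
      FourQubit.isSeparableAB_of_mem_polytopePs⟩, Set.Subset.antisymm ?_ ?_⟩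
  · rintro ρ ⟨hρ, hsep⟩
    have hρ' := FourQubit.symStates_eq ▸ hρ
    obtain ⟨r, -, rfl⟩ := hρ'
    exact ⟨r, FourQubit.mem_polytopePs_of_isSeparableAB (hsum r hρ) hsep, rfl⟩
  · rintro _ ⟨r, hr, rfl⟩
    exact ⟨hmem r hr, FourQubit.isSeparableAB_of_mem_polytopePs hr⟩
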